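/- For $N\ge 1$ let $\|\cdot\|$ be the Euclidean norm on $\mathbb R^N$, $\|\cdot\|_{op}$ the corresponding operator norm, and $\boldsymbol B^N=\{x\in\mathbb R^N:\|x\|\le\sqrt N\}$. Let $J=(J^{(p)}_{i_1,\dots,i_p})_{p\ge 2,\;1\le i_1,\dots,i_p\le N}$ be independent real random variables with mean $0$ and variance $1$ satisfying, with a constant $K>0$, the uniform logarithmic Sobolev condition (LS) for every entry $X=J^{(p)}_{i_1,\dots,i_p}$ and every differentiable $f:\mathbb R\to\mathbb R$ with $\mathbb E[f(X)^2]=1$, $\quad\mathbb E[f(X)^2\log f(X)^2]\le 2K\,\mathbb E[f'(X)^2]$. For $p\ge2$ put $H_N^{(p)}(x)=N^{-(p-1)/2}\sum_{i_1,\dots,i_p=1}^N J^{(p)}_{i_1,\dots,i_p}x_{i_1}\cdots x_{i_p}$, let $\nabla_E^2H_N^{(p)}(x)$ be its Euclidean Hessian matrix, and for $v\in\mathbb R^N$ let $$\partial_v^iH_N^{(p)}(x)=N^{-(p-1)/2}\sum_{j_1,\dots,j_i=1}^N v_{j_1}\cdots v_{j_i}\sum_{i_1,\dots,i_p=1}^N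 J^{(p)}_{i_1,\dots,i_p}\,\partial_{j_1}\cdots\partial_{j_i}(x_{i_1}\cdots x_{i_p})$$ be its $i$-th directional derivative. For real $\gamma=(\gamma_p)_{p\ge2}$ such that $\xi(z)=\sum_{p\ge2}\gamma_p^2z^p$ has radius of convergence greater than $1$, put $H_N=\sum_{p\ge2}\gamma_pH_N^{(p)}$, $\partial_v^iH_N=\sum_{p\ge2}\gamma_p\,\partial_v^iH_N^{(p)}$ and $\nabla_E^2H_N=\sum_{p\ge2}\gamma_p\nabla_E^2H_N^{(p)}$. **Pure models.** There is an absolute constant $C>0$ such that for all $K>0$, all $N\ge1$ and all $J$ as above: - for all $p\ge2$, $$\mathbb P\Big(\sup_{x\in\boldsymbol B^N}\|\nabla_E^2H_N^{(p)}(x)\|_{op}\ge 2C\sqrt K\,p^{3/2}(p-1)\Big)\le\exp\Big(-\frac{C^2p}{2}N\Big);$$ - for all $i\in\{1,2,3\}$ and $p\ge\max\{2,i\}$, $$\mathbb P\Big(\exists x\in\boldsymbol B^N,\ \exists v\in\mathbb R^N\text{ with }\|v\|=1:\ |\partial_v^iH_N^{(p)}(x)|\ge\frac{2C\sqrt{Kp}}{N^{(i-2)/2}}\frac{p!}{(p-i)!}\Big)\le\exp\Big(-\frac{C^2p}{2}N\Big);$$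 - for all $p\ge3$, $$\mathbb P\Big(\exists x\ne y\in\boldsymbol B^N:\ \|\nabla_E^2H_N^{(p)}(x)-\nabla_E^2H_N^{(p)}(y)\|_{op}\ge\frac{2C\sqrt{Kp}}{\sqrt N}\frac{p!}{(p-3)!}\|x-y\|\Big)\le\exp\Big(-\frac{C^2p}{2}N\Big).$$ **Mixed models.** There are constants $R,c>0$ depending only on $\xi$ and $K$ such that for all $N\ge1$ and all $J$ as above, almost surely the series for $H_N$, $\partial_v^iH_N$ ($i=1,2,3$, $v\in\mathbb R^N$) and $\nabla_E^2H_N$ converge at every point of $\boldsymbol B^N$, $H_N$ is three times continuously differentiable there, and the last two series are its directional derivatives and its Hessian; moreover, for $i=1,2,3$, $$\mathbb P\Big(\forall x\in\boldsymbol B^N,\ \forall v\in\mathbb R^N\text{ with }\|v\|=1:\ |\partial_v^iH_N(x)|<R\,N^{1-i/2}\Big)\ge1-e^{-cN},$$ $$\mathbb P\Big(\forall x\ne y\in\boldsymbol B^N:\ \|\nabla_E^2H_N(x)-\nabla_E^2H_N(y)\|_{op}<\frac{R}{\sqrt N}\|x-y\|\Big)\ge1-e^{-cN}.$$ -/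

import Mathlib

open MeasureTheory ProbabilityTheory
open scoped Nat ENNReal

noncomputable section

namespace SpinGlass

/-- `ℝ^N` with the Euclidean norm. -/
abbrev Vec (N : ℕ) : Type := EuclideanSpace ℝ (Fin N)

/-- The closed Euclidean ball of radius `√N`. -/
def ball (N : ℕ) : Set (Vec N) := {x | ‖x‖ ≤ √(N : ℝ)}

/-- The logarithmic Sobolev inequality with constant `K` for a law `ν` on `ℝ`: for every
differentiable `f` with `∫ f² dν = 1`, one has `∫ f² log f² dν ≤ 2 K ∫ (f')² dν`.
When `∫ (f')² dν = ∞` the inequality says nothing, and when it is finite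
the left-hand side (whose negative part is always integrable) has to be finite. -/
def LogSobolev (ν : Measure ℝ) (K : ℝ) : Prop :=
  ∀ f : ℝ → ℝ, Differentiable ℝ f → ∫ x, f x ^ 2 ∂ν = 1 →
    Integrable (fun x => deriv f x ^ 2) ν →
      Integrable (fun x => f x ^ 2 * Real.log (f x ^ 2)) ν ∧
        ∫ x, f x ^ 2 * Real.log (f x ^ 2) ∂ν ≤ 2 * K * ∫ x, deriv f x ^ 2 ∂ν

/-- Indices of the disorder: a degree `p ≥ 2` and a multi-index `(i_1, …, i_p)`. -/
abbrev DisorderIndex (N : ℕ) : Type := Σ p : {p : ℕ // 2 ≤ p}, (Fin p.1 → Fin N)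

/-- The random variables `J p (i_1, …, i_p)`, `p ≥ 2`, are independent, with mean `0` and
variance `1`, and their laws satisfy the logarithmic Sobolev inequality with the same
constant `K`. The entries with `p < 2` play no role. -/
structure IsDisorder {N : ℕ} {Ω : Type*} [MeasurableSpace Ω] (P : Measure Ω) (K : ℝ)
    (J : (p : ℕ) → (Fin p → Fin N) → Ω → ℝ) : Prop where
  measurable : ∀ p, 2 ≤ p → ∀ idx, Measurable (J p idx)
  indep : iIndepFun (fun q : DisorderIndex N => J q.1.1 q.2) P
  mean : ∀ p, 2 ≤ p → ∀ idx, ∫ ω, J p idx ω ∂P = 0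
  var : ∀ p, 2 ≤ p → ∀ idx, variance (J p idx) P = 1
  logSobolev : ∀ p, 2 ≤ p → ∀ idx, LogSobolev (P.map (J p idx)) K

/-- The monomial `x_{i_1} ⋯ x_{i_p}`. -/
def mono {p N : ℕ} (idx : Fin p → Fin N) (x : Vec N) : ℝ := ∏ k, x (idx k)

/-- The partial derivative `∂_{j_1} ⋯ ∂_{j_i} F (x)`: the `i`-th derivative of `F` at `x` applied
to the basis vectors `e_{j_1}, …, e_{j_i}`. -/
def partialD {i N : ℕ} (j : Fin i → Fin N) (F : Vec N → ℝ) (x : Vec N) : ℝ :=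
  iteratedFDeriv ℝ i F x (fun a => EuclideanSpace.single (j a) (1 : ℝ))

/-- The normalisation `1 / N^{(p-1)/2}`. -/
def scale (N p : ℕ) : ℝ := 1 / (N : ℝ) ^ (((p : ℝ) - 1) / 2)

section Pure

variable {N : ℕ} (p : ℕ) (J : (Fin p → Fin N) → ℝ)

/-- The pure `p`-spin Hamiltonian for a realisation `J` of the disorder of degree `p`. -/
def pureH (x : Vec N) : ℝ := scale N p * ∑ idx : Fin p → Fin N, J idx * mono idx x

/-- The `i`-th directional derivative of the pure `p`-spin Hamiltonian in direction `v`. -/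
def pureDir (i : ℕ) (v x : Vec N) : ℝ :=
  scale N p * ∑ j : Fin i → Fin N, (∏ a, v (j a)) *
    ∑ idx : Fin p → Fin N, J idx * partialD j (mono idx) x

/-- The Euclidean Hessian matrix of the pure `p`-spin Hamiltonian. -/
def pureHess (x : Vec N) : Matrix (Fin N) (Fin N) ℝ :=
  Matrix.of fun j k =>
    scale N p * ∑ idx : Fin p → Fin N, J idx * partialD ![j, k] (mono idx) x

end Pure

section Mixed

variable {N : ℕ} (γ : ℕ → ℝ) (J : (p : ℕ) → (Fin p → Fin N) → ℝ)

/-- The mixed Hamiltonian `H_N = ∑_{p ≥ 2} γ_p H_N^{(p)}` (the summation index is `n = p - 2`). -/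
def mixedH (x : Vec N) : ℝ := ∑' n : ℕ, γ (n + 2) * pureH (n + 2) (J (n + 2)) x

/-- The `i`-th directional derivative `∑_{p ≥ 2} γ_p ∂_v^i H_N^{(p)}` of the mixed Hamiltonian. -/
def mixedDir (i : ℕ) (v x : Vec N) : ℝ :=
  ∑' n : ℕ, γ (n + 2) * pureDir (n + 2) (J (n + 2)) i v x

/-- The Euclidean Hessian `∑_{p ≥ 2} γ_p ∇_E² H_N^{(p)}` of the mixed Hamiltonian. -/
def mixedHess (x : Vec N) : Matrix (Fin N) (Fin N) ℝ :=
  Matrix.of fun j k => ∑' n : ℕ, γ (n + 2) * pureHess (n + 2) (J (n + 2)) x j k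

/-- All the series above converge at every point of the ball, the function `mixedH` is three
times continuously differentiable there, and the series `mixedDir`, `mixedHess` are
its directional derivatives of order `1, 2, 3` and its Hessian. -/
def WellDefined : Prop :=
  ∀ x ∈ ball N,
    Summable (fun n : ℕ => γ (n + 2) * pureH (n + 2) (J (n + 2)) x) ∧
    ContDiffAt ℝ 3 (mixedH γ J) x ∧
    (∀ i ∈ ({1, 2, 3} : Set ℕ), ∀ v : Vec N,
      Summable (fun n : ℕ => γ (n + 2) * pureDir (n + 2) (J (n + 2)) i v x) ∧
      mixedDir γ J i v x = iteratedFDeriv ℝ i (mixedH γ J) x (fun _ => v)) ∧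
    (∀ j k : Fin N,
      Summable (fun n : ℕ => γ (n + 2) * pureHess (n + 2) (J (n + 2)) x j k) ∧
      mixedHess γ J x j k = partialD ![j, k] (mixedH γ J) x)

end Mixed

/-- The operator norm of a matrix with respect to the Euclidean norm. -/
def opNorm {N : ℕ} (A : Matrix (Fin N) (Fin N) ℝ) : ℝ :=
  ‖Matrix.toEuclideanCLM (𝕜 := ℝ) (n := Fin N) A‖

/-- The coefficients of the power series `ξ(z) = ∑_{p ≥ 2} γ_p² z^p`. -/
def xiCoeff (γ : ℕ → ℝ) (p : ℕ) : ℝ := if 2 ≤ p then γ p ^ 2 else 0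

/-- The radius of convergence of the real power series with coefficients `a`. -/
def seriesRadius (a : ℕ → ℝ) : ℝ≥0∞ := (FormalMultilinearSeries.ofScalars ℝ a).radius

end SpinGlass

end

/-! On `ball N`, everything is controlled by one random number per degree. Since `pureH` is `scale N
p` times the diagonal of the symmetrized disorder form `S`, its `n`-th derivative has norm at most
`p!/(p-n)! * ‖S‖ * N^((1-n)/2)`. All three pure bounds therefore follow from `‖S‖ < 8 √(K p N)`,
that is, `C = 4`.

By Banach's theorem (`exists_diagonal_eq_norm_of_symmetric`) `‖S‖` is attained on the diagonal, so a
net of a single unit ball suffices. With mesh `1/(4p)` it has at most `(1+8p)^N` points. A net for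
`p` independent arguments would have entropy of order `p N log p`, too much for an absolute `C`, and
polarization would cost `p^p/p!`. At a net point the Hamiltonian is a sum of independent terms with
variance proxy at most `K`, by Herbst's argument (`LogSobolev.hasSubgaussianMGF`). A union bound
then gives `IsDisorder.measure_spinNorm_ge_le`.

For mixed models the failure probabilities sum over `p` to at most `exp(-8N)`. Outside these events
the series are dominated by `mixedWeight`, summable because radius of convergence above `1` makes
`√|a p|` decay geometrically. The almost sure claims hold for every `N` by Borel–Cantelli, as
finitely many exceptional degrees do not affect convergence. -/

namespace SpinGlass

/-! ### Banach's theorem on symmetric multilinear forms -/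

section Banach

variable {ι E : Type*} [Fintype ι] [NormedAddCommGroup E] [InnerProductSpace ℝ E]

theorem exists_unit_multilinear_eq_norm [FiniteDimensional ℝ E] [Nontrivial E]
    (f : ContinuousMultilinearMap ℝ (fun _ : ι => E) ℝ) :
    ∃ m : ι → E, (∀ i, ‖m i‖ = 1) ∧ |f m| = ‖f‖ := by
  have hc : IsCompact (Set.univ.pi fun _ : ι => Metric.sphere (0 : E) 1) :=
    isCompact_univ_pi fun _ => isCompact_sphere 0 1
  obtain ⟨e, he⟩ := exists_norm_eq E zero_le_one
  obtain ⟨m, hm, hmax⟩ := hc.exists_isMaxOn (f := fun m => |f m|) ⟨fun _ => e, by simp [he]⟩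
    (f.cont.abs.continuousOn)
  have hm' : ∀ i, ‖m i‖ = 1 := fun i => by simpa using hm i trivial
  refine ⟨m, hm', le_antisymm ?_ ?_⟩
  · simpa [hm'] using f.le_opNorm m
  · refine f.opNorm_le_bound (abs_nonneg _) fun v => ?_
    by_cases hv : ∃ i, v i = 0
    · obtain ⟨i, hi⟩ := hv
      rw [f.map_coord_zero i hi, norm_zero]
      positivity
    · push Not at hv
      have h1 : v = fun i => ‖v i‖ • (‖v i‖⁻¹ • v i) := by
        ext1 i
        rw [smul_inv_smul₀ (norm_ne_zero_iff.2 (hv i))]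
      have h2 : |f fun i => ‖v i‖⁻¹ • v i| ≤ |f m| := hmax (by
        intro i _
        simp [norm_smul, hv i])
      conv_lhs => rw [h1]
      rw [f.map_smul_univ, norm_smul, Real.norm_of_nonneg (by positivity), mul_comm]
      exact mul_le_mul_of_nonneg_right h2 (by positivity)

/-- Among the unit tuples attaining the norm, take one whose sum is longest. If two entries
differed, both could be replaced by `u` or both by `-u`, where `u` is the direction of their sum.
The norm is still attained, and one of the two choices lengthens the sum. -/
theorem exists_diagonal_eq_norm_of_symmetric [FiniteDimensional ℝ E] [Nontrivial E]
    (f : ContinuousMultilinearMap ℝ (fun _ : ι => E) ℝ)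
    (hf : ∀ (σ : Equiv.Perm ι) (m : ι → E), f (fun i => m (σ i)) = f m) :
    ∃ x : E, ‖x‖ = 1 ∧ |f fun _ => x| = ‖f‖ := by
  classical
  have hc : IsCompact ((Set.univ.pi fun _ : ι => Metric.sphere (0 : E) 1) ∩
      {m | |f m| = ‖f‖}) :=
    (isCompact_univ_pi fun _ => isCompact_sphere 0 1).inter_right
      (isClosed_eq f.cont.abs continuous_const)
  obtain ⟨m₀, h₀, h₀'⟩ := exists_unit_multilinear_eq_norm f
  obtain ⟨m, ⟨hm, hfm⟩, hmax⟩ := hc.exists_isMaxOn (f := fun m : ι → E => ‖∑ i, m i‖)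
    ⟨m₀, by simp [h₀], h₀'⟩ (by fun_prop)
  have hm1 : ∀ i, ‖m i‖ = 1 := fun i => by simpa using hm i trivial
  simp only [Set.mem_ofPred_eq] at hfm
  have key : ∀ i j, m i = m j := by
    intro i j
    by_contra hne
    have hij : i ≠ j := fun h => hne (by rw [h])
    let B : E → E → ℝ := fun u w => f (Function.update (Function.update m i u) j w)
    have hBxy : B (m i) (m j) = f m := by simp [B]
    have hBl : ∀ (a b : ℝ) u v w, B (a • u + b • v) w = a * B u w + b * B v w := by
      intro a b u v w
      simp only [B]
      simp only [Function.update_comm hij, f.map_update_add, f.map_update_smul, smul_eq_mul]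
    have hBr : ∀ (a b : ℝ) u v w, B w (a • u + b • v) = a * B w u + b * B w v := by
      intro a b u v w
      simp only [B, f.map_update_add, f.map_update_smul, smul_eq_mul]
    have hBs : ∀ u w, B u w = B w u := by
      intro u w
      simp only [B]
      rw [← hf (Equiv.swap i j)]
      congr 1
      ext1 k
      by_cases h1 : k = i
      · subst h1; simp [hij]
      · by_cases h2 : k = j
        · subst h2; simp [hij]
        · simp [Equiv.swap_apply_of_ne_of_ne h1 h2, h1, h2]
    have hBle : ∀ u w, |B u w| ≤ ‖f‖ * (‖u‖ * ‖w‖) := by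
      intro u w
      refine (f.le_opNorm _).trans_eq ?_
      congr 1
      rw [← Finset.mul_prod_erase _ _ (Finset.mem_univ i),
        ← Finset.mul_prod_erase _ _ (Finset.mem_erase.2 ⟨hij.symm, Finset.mem_univ j⟩),
        Finset.prod_eq_one]
      · simp [hij]
      · intro k hk
        simp only [Finset.mem_erase, Finset.mem_univ, and_true] at hk
        simp [hk.1, hk.2, hm1]
    set r : E := ∑ k, m k - m i - m j with hr
    have hmaxB : ∀ u, ‖u‖ = 1 → |B u u| = ‖f‖ → ‖r + (2 : ℝ) • u‖ ≤ ‖r + (m i + m j)‖ := by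
      intro u hu hB
      have h1 := hmax (a := Function.update (Function.update m i u) j u) ⟨by
        intro k _
        by_cases h2 : k = j
        · subst h2; simp [hu]
        · by_cases h1 : k = i
          · subst h1; simp [hij, hu]
          · simp [h1, h2, hm1], hB⟩
      simp only [Set.mem_ofPred_eq] at h1
      have h2 : ∑ k, Function.update (Function.update m i u) j u k = r + (2 : ℝ) • u := by
        rw [hr, two_smul, ← Finset.add_sum_erase _ _ (Finset.mem_univ i),
          ← Finset.add_sum_erase _ _ (Finset.mem_erase.2 ⟨hij.symm, Finset.mem_univ j⟩),
          ← Finset.add_sum_erase _ m (Finset.mem_univ i),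
          ← Finset.add_sum_erase _ m (Finset.mem_erase.2 ⟨hij.symm, Finset.mem_univ j⟩)]
        rw [Finset.sum_congr (g := m) rfl]
        · simp [hij]; abel
        · intro k hk
          simp only [Finset.mem_erase, Finset.mem_univ, and_true] at hk
          simp [hk.1, hk.2]
      rw [h2] at h1
      refine h1.trans_eq ?_
      congr 1
      rw [hr]; abel
    have hpar := parallelogram_law_with_norm ℝ (m i) (m j)
    rw [hm1, hm1] at hpar
    have hsub : 0 < ‖m i - m j‖ := norm_pos_iff.2 (sub_ne_zero.2 hne)
    -- Polarization writes `4 B(x,y)` as `B(x+y,x+y) - B(x-y,x-y)`. Bounding the last term by `‖f‖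
    -- ‖x-y‖²` and using the parallelogram law leaves `|B(x+y,x+y)| ≥ ‖f‖ ‖x+y‖²`.
    obtain ⟨u, hu, hxy, hBu⟩ : ∃ u, ‖u‖ = 1 ∧ m i + m j = ‖m i + m j‖ • u ∧ |B u u| = ‖f‖ := by
      by_cases h0 : m i + m j = 0
      · refine ⟨m i, hm1 i, by simp [h0], ?_⟩
        have h1 : m j = (-1 : ℝ) • m i + (0 : ℝ) • m i := by
          rw [zero_smul, add_zero, neg_one_smul]; exact (neg_eq_of_add_eq_zero_right h0).symm
        rw [← hfm, ← hBxy]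
        conv_rhs => rw [h1, hBr]
        simp
      · have hρ : 0 < ‖m i + m j‖ := norm_pos_iff.2 h0
        have hun : ‖‖m i + m j‖⁻¹ • (m i + m j)‖ = 1 := by
          rw [norm_smul, norm_inv, norm_norm, inv_mul_cancel₀ hρ.ne']
        refine ⟨‖m i + m j‖⁻¹ • (m i + m j), hun, by rw [smul_inv_smul₀ hρ.ne'], le_antisymm ?_ ?_⟩
        · exact (hBle _ _).trans_eq (by rw [hun]; ring)
        · have e1 : B (m i + m j) (m i + m j) =
              B (m i) (m i) + 2 * B (m i) (m j) + B (m j) (m j) := by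
            have := hBl 1 1 (m i) (m j) (m i + m j)
            have h2 := hBr 1 1 (m i) (m j) (m i)
            have h3 := hBr 1 1 (m i) (m j) (m j)
            simp only [one_smul, one_mul] at this h2 h3
            rw [this, h2, h3, hBs (m j) (m i)]; ring
          have e2 : B (m i - m j) (m i - m j) =
              B (m i) (m i) - 2 * B (m i) (m j) + B (m j) (m j) := by
            have := hBl 1 (-1) (m i) (m j) (m i - m j)
            have h2 := hBr 1 (-1) (m i) (m j) (m i)
            have h3 := hBr 1 (-1) (m i) (m j) (m j)
            simp only [one_smul, one_mul, neg_one_smul, ← sub_eq_add_neg] at this h2 h3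
            rw [this, h2, h3, hBs (m j) (m i)]; ring
          have e3 := hBle (m i - m j) (m i - m j)
          have e4 : 4 * |B (m i) (m j)| ≤
              |B (m i + m j) (m i + m j)| + |B (m i - m j) (m i - m j)| := by
            rw [← abs_of_pos (show (0 : ℝ) < 4 by norm_num), ← abs_mul]
            refine le_trans (le_of_eq ?_) (abs_sub _ _)
            rw [e1, e2]; congr 1; ring
          have e5 : B (‖m i + m j‖⁻¹ • (m i + m j)) (‖m i + m j‖⁻¹ • (m i + m j)) =
              (‖m i + m j‖ ^ 2)⁻¹ * B (m i + m j) (m i + m j) := by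
            have := hBl (‖m i + m j‖⁻¹) 0 (m i + m j) 0 (‖m i + m j‖⁻¹ • (m i + m j))
            have h2 := hBr (‖m i + m j‖⁻¹) 0 (m i + m j) 0 (m i + m j)
            simp only [zero_smul, add_zero, zero_mul] at this h2
            rw [this, h2]; ring
          rw [e5, abs_mul, abs_of_pos (by positivity), ← div_eq_inv_mul, le_div_iff₀ (by positivity)]
          rw [hBxy, hfm] at e4
          have e6 : ‖f‖ * (‖m i - m j‖ * ‖m i - m j‖) = ‖f‖ * (4 - ‖m i + m j‖ ^ 2) := by
            congr 1; linarith
          linarith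
    have hB' : |B (-u) (-u)| = ‖f‖ := by
      have := hBl (-1) 0 u 0 (-u)
      have h2 := hBr (-1) 0 u 0 u
      simp only [zero_smul, add_zero, zero_mul, neg_one_smul] at this h2
      rw [this, h2, ← hBu]; congr 1; ring
    -- Maximality against `u` forces `2⟪r,u⟫ ≤ -(2+ρ)`, and against `-u` it forces `2⟪r,u⟫ ≥ 2-ρ`.
    -- These are incompatible.
    have k1 := hmaxB u hu hBu
    have k2 := hmaxB (-u) (by rwa [norm_neg]) hB'
    set ρ := ‖m i + m j‖
    have hρ0 : 0 ≤ ρ := norm_nonneg _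
    have hρ2 : ρ < 2 := by nlinarith
    rw [hxy] at k1 k2
    have s1 := pow_le_pow_left₀ (norm_nonneg _) k1 2
    have s2 := pow_le_pow_left₀ (norm_nonneg _) k2 2
    rw [smul_neg, ← sub_eq_add_neg, norm_sub_sq_real, norm_add_sq_real] at s2
    rw [norm_add_sq_real, norm_add_sq_real] at s1
    simp only [norm_smul, hu, inner_smul_right, Real.norm_eq_abs, abs_of_nonneg hρ0,
      abs_of_pos (show (0 : ℝ) < 2 by norm_num)] at s1 s2
    have c1 : (2 - ρ) * (2 + ρ + 2 * inner ℝ r u) ≤ 0 := by nlinarith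
    have c2 : (2 + ρ) * (2 - ρ - 2 * inner ℝ r u) ≤ 0 := by nlinarith
    have d1 : 2 + ρ + 2 * inner ℝ r u ≤ 0 := by
      by_contra! h
      nlinarith [mul_pos (sub_pos.2 hρ2) h]
    have d2 : 2 - ρ - 2 * inner ℝ r u ≤ 0 := by
      by_contra! h
      nlinarith [mul_pos (show 0 < 2 + ρ by linarith) h]
    linarith
  rcases isEmpty_or_nonempty ι with h | ⟨⟨i⟩⟩
  · obtain ⟨e, he⟩ := exists_norm_eq E zero_le_one
    exact ⟨e, he, by rw [← hfm]; congr 2; exact Subsingleton.elim _ _⟩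
  · refine ⟨m i, hm1 i, ?_⟩
    rw [← hfm]
    congr 2
    ext1 k
    exact key i k

/-- The average of a multilinear form over all permutations of its arguments. -/
noncomputable def symmetrization [DecidableEq ι] (f : ContinuousMultilinearMap ℝ (fun _ : ι => E) ℝ) :
    ContinuousMultilinearMap ℝ (fun _ : ι => E) ℝ :=
  ((Fintype.card (Equiv.Perm ι) : ℝ)⁻¹) • ∑ σ : Equiv.Perm ι, f.domDomCongr σ

variable [DecidableEq ι]

theorem symmetrization_apply (f : ContinuousMultilinearMap ℝ (fun _ : ι => E) ℝ) (m : ι → E) :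
    symmetrization f m =
      (Fintype.card (Equiv.Perm ι) : ℝ)⁻¹ * ∑ σ : Equiv.Perm ι, f fun i => m (σ i) := by
  simp [symmetrization]

theorem symmetrization_diagonal (f : ContinuousMultilinearMap ℝ (fun _ : ι => E) ℝ) (x : E) :
    symmetrization f (fun _ => x) = f fun _ => x := by
  have : (Fintype.card (Equiv.Perm ι) : ℝ) ≠ 0 := Nat.cast_ne_zero.2 Fintype.card_ne_zero
  simp only [symmetrization_apply, Finset.sum_const, Finset.card_univ, nsmul_eq_mul]
  rw [inv_mul_cancel_left₀ this]

theorem symmetrization_perm (f : ContinuousMultilinearMap ℝ (fun _ : ι => E) ℝ)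
    (σ : Equiv.Perm ι) (m : ι → E) :
    symmetrization f (fun i => m (σ i)) = symmetrization f m := by
  simp only [symmetrization_apply]
  congr 1
  exact Fintype.sum_equiv (Equiv.mulLeft σ) _ _ fun τ => rfl

theorem exists_diagonal_eq_norm_symmetrization [FiniteDimensional ℝ E] [Nontrivial E]
    (f : ContinuousMultilinearMap ℝ (fun _ : ι => E) ℝ) :
    ∃ x : E, ‖x‖ = 1 ∧ |f fun _ => x| = ‖symmetrization f‖ := by
  obtain ⟨x, hx, h⟩ := exists_diagonal_eq_norm_of_symmetric _ (symmetrization_perm f)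
  exact ⟨x, hx, by rwa [symmetrization_diagonal] at h⟩

end Banach

/-- The product carries the sup norm, so the diagonal embedding has norm at most `1` and restricting
to the diagonal loses no factor. -/
theorem norm_iteratedFDeriv_diagonal_le {p : ℕ} {E : Type*} [NormedAddCommGroup E]
    [NormedSpace ℝ E] (f : ContinuousMultilinearMap ℝ (fun _ : Fin p => E) ℝ) (n : ℕ) (x : E) :
    ‖iteratedFDeriv ℝ n (fun x => f fun _ => x) x‖ ≤
      p.descFactorial n * ‖f‖ * ‖x‖ ^ (p - n) := by
  let D : E →L[ℝ] (Fin p → E) := ContinuousLinearMap.pi fun _ => ContinuousLinearMap.id ℝ E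
  have hD : ∀ y, ‖D y‖ ≤ ‖y‖ := fun y =>
    (pi_norm_le_iff_of_nonneg (norm_nonneg _)).2 fun _ => le_rfl
  have hD1 : ‖D‖ ≤ 1 := D.opNorm_le_bound zero_le_one fun y => by simpa using hD y
  have h1 : (fun x => f fun _ => x) = f ∘ D := rfl
  rw [h1, D.iteratedFDeriv_comp_right (n := n) f.contDiff x le_rfl]
  refine (ContinuousMultilinearMap.norm_compContinuousLinearMap_le _ _).trans ?_
  refine (mul_le_of_le_one_right (norm_nonneg _)
    (Finset.prod_le_one (fun _ _ => norm_nonneg _) fun _ _ => hD1)).trans ?_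
  refine (f.norm_iteratedFDeriv_le n (D x)).trans ?_
  rw [Fintype.card_fin]
  gcongr
  exact hD x

end SpinGlass

namespace SpinGlass

/-! ### Nets of the unit ball -/

section Net

open Module

variable {E : Type*} [NormedAddCommGroup E] [NormedSpace ℝ E] [FiniteDimensional ℝ E]

open scoped Function in
-- Volume comparison: the balls of radius `ε/2` around the points are disjoint and lie in the ball
-- of radius `1 + ε/2`.
theorem card_le_of_separated_unit_ball {ε : ℝ} (hε : 0 < ε) (s : Finset E)
    (hs : ∀ c ∈ s, ‖c‖ ≤ 1) (h : ∀ c ∈ s, ∀ d ∈ s, c ≠ d → ε ≤ ‖c - d‖) :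
    (s.card : ℝ) ≤ (1 + 2 / ε) ^ finrank ℝ E := by
  borelize E
  let μ : Measure E := Measure.addHaar
  have hρ : 0 < 1 + ε / 2 := by positivity
  have hδ : 0 < ε / 2 := by positivity
  have D : Set.Pairwise (s : Set E) (Disjoint on fun c => Metric.ball (c : E) (ε / 2)) := by
    rintro c hc d hd hcd
    apply Metric.ball_disjoint_ball
    rw [dist_eq_norm]
    linarith [h c hc d hd hcd]
  have hsub : (⋃ c ∈ s, Metric.ball (c : E) (ε / 2)) ⊆ Metric.ball (0 : E) (1 + ε / 2) := by
    refine Set.iUnion₂_subset fun x hx => Metric.ball_subset_ball' ?_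
    rw [dist_zero_right]
    linarith [hs x hx]
  have I : (s.card : ℝ≥0∞) * ENNReal.ofReal ((ε / 2) ^ finrank ℝ E) * μ (Metric.ball 0 1) ≤
      ENNReal.ofReal ((1 + ε / 2) ^ finrank ℝ E) * μ (Metric.ball 0 1) :=
    calc
      (s.card : ℝ≥0∞) * ENNReal.ofReal ((ε / 2) ^ finrank ℝ E) * μ (Metric.ball 0 1) =
          μ (⋃ c ∈ s, Metric.ball (c : E) (ε / 2)) := by
        rw [measure_biUnion_finset D fun c _ => measurableSet_ball]
        simp only [μ.addHaar_ball_of_pos _ hδ, Finset.sum_const, nsmul_eq_mul, mul_assoc]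
      _ ≤ μ (Metric.ball (0 : E) (1 + ε / 2)) := measure_mono hsub
      _ = _ := by rw [μ.addHaar_ball_of_pos _ hρ]
  have J := (ENNReal.mul_le_mul_iff_left (Metric.measure_ball_pos μ _ zero_lt_one).ne'
    measure_ball_lt_top.ne).1 I
  have K : (s.card : ℝ) ≤ ((1 + ε / 2) ^ finrank ℝ E) / (ε / 2) ^ finrank ℝ E := by
    rw [le_div_iff₀ (by positivity)]
    simpa [ENNReal.toReal_mul, ENNReal.toReal_ofReal (pow_nonneg hδ.le _)] using
      ENNReal.toReal_le_of_le_ofReal (by positivity) J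
  refine K.trans_eq ?_
  rw [← div_pow]
  congr 1
  field_simp
  ring

theorem exists_net_unit_ball (E : Type*) [NormedAddCommGroup E] [NormedSpace ℝ E]
    [FiniteDimensional ℝ E] {ε : ℝ} (hε : 0 < ε) :
    ∃ s : Finset E, (∀ c ∈ s, ‖c‖ ≤ 1) ∧ (∀ x : E, ‖x‖ ≤ 1 → ∃ c ∈ s, ‖x - c‖ ≤ ε) ∧
      (s.card : ℝ) ≤ (1 + 2 / ε) ^ finrank ℝ E := by
  classical
  -- A separated set of maximal cardinality is a net: an uncovered point could be added to it.
  let A : Set ℕ := {n | ∃ s : Finset E, s.card = n ∧ (∀ c ∈ s, ‖c‖ ≤ 1) ∧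
    ∀ c ∈ s, ∀ d ∈ s, c ≠ d → ε ≤ ‖c - d‖}
  have hA : A.Nonempty := ⟨0, ∅, by simp⟩
  have hb : BddAbove A := by
    refine ⟨⌊(1 + 2 / ε) ^ finrank ℝ E⌋₊, ?_⟩
    rintro _ ⟨s, rfl, h1, h2⟩
    exact Nat.le_floor (card_le_of_separated_unit_ball hε s h1 h2)
  obtain ⟨s, hcard, h1, h2⟩ := Nat.sSup_mem hA hb
  refine ⟨s, h1, fun x hx => ?_, card_le_of_separated_unit_ball hε s h1 h2⟩
  by_contra! hcon
  have hxs : x ∉ s := fun hxs => by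
    have := hcon x hxs
    rw [sub_self, norm_zero] at this
    exact this.not_gt hε
  have hmem : (insert x s).card ∈ A := by
    refine ⟨_, rfl, ?_, ?_⟩
    · intro c hc
      rcases Finset.mem_insert.1 hc with rfl | hc
      exacts [hx, h1 c hc]
    · intro c hc d hd hcd
      rcases Finset.mem_insert.1 hc with rfl | hc' <;> rcases Finset.mem_insert.1 hd with rfl | hd
      · exact absurd rfl hcd
      · exact (hcon d hd).le
      · rw [norm_sub_rev]; exact (hcon c hc').le
      · exact h2 c hc' d hd hcd
  have := le_csSup hb hmem
  rw [Finset.card_insert_of_notMem hxs] at this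
  omega

end Net

end SpinGlass

namespace SpinGlass

/-! ### Herbst's argument: from log-Sobolev to sub-Gaussian -/

section Herbst

open Real Filter Topology

variable {ν : Measure ℝ} [IsProbabilityMeasure ν] {K : ℝ} {g : ℝ → ℝ} {B : ℝ}

theorem integrable_exp_mul_of_bounded (hg : Measurable g) (hB : ∀ x, |g x| ≤ B) (t : ℝ) :
    Integrable (fun x => exp (t * g x)) ν := by
  refine Integrable.of_bound (by fun_prop) (exp (|t| * B)) (ae_of_all _ fun x => ?_)
  rw [Real.norm_eq_abs, abs_exp, exp_le_exp]
  refine (le_abs_self _).trans ?_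
  rw [abs_mul]
  exact mul_le_mul_of_nonneg_left (hB x) (abs_nonneg t)

/-- Apply the inequality to `f² = exp(t g)/Z`: its entropy is the left-hand side, and `|g'| ≤ 1`
gives `f'² ≤ (t²/4) f²`. -/
theorem LogSobolev.mul_deriv_cgf_sub_cgf_le (h : LogSobolev ν K) (hK : 0 ≤ K)
    (hg : Differentiable ℝ g) (hB : ∀ x, |g x| ≤ B) (hg' : ∀ x, |deriv g x| ≤ 1) (t : ℝ) :
    t * deriv (cgf g ν) t - cgf g ν t ≤ K * t ^ 2 / 2 := by
  have hint := integrable_exp_mul_of_bounded (ν := ν) hg.continuous.measurable hB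
  have hZ : 0 < mgf g ν t := mgf_pos (hint t)
  set Z := mgf g ν t with hZdef
  let f : ℝ → ℝ := fun x => exp (t * g x / 2) / √Z
  have hf2 : ∀ x, f x ^ 2 = exp (t * g x) / Z := by
    intro x
    simp only [f]
    rw [div_pow, sq_sqrt hZ.le, ← exp_nat_mul]
    congr 2
    push_cast
    ring
  have hfd : ∀ x, HasDerivAt f (f x * (t / 2 * deriv g x)) x := by
    intro x
    have h1 : HasDerivAt (fun x => t * g x / 2) (t * deriv g x / 2) x :=
      ((hg x).hasDerivAt.const_mul t).div_const 2
    refine (h1.exp.div_const (√Z)).congr_deriv ?_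
    simp only [f]
    ring
  have hfdiff : Differentiable ℝ f := fun x => (hfd x).differentiableAt
  have hf2int : Integrable (fun x => f x ^ 2) ν := by
    simp only [hf2]
    exact (hint t).div_const Z
  have hone : ∫ x, f x ^ 2 ∂ν = 1 := by
    simp only [hf2]
    rw [integral_div]
    exact div_self hZ.ne'
  have hle : ∀ x, deriv f x ^ 2 ≤ t ^ 2 / 4 * f x ^ 2 := by
    intro x
    rw [(hfd x).deriv]
    have : deriv g x ^ 2 ≤ 1 := (sq_le_one_iff_abs_le_one _).2 (hg' x)
    calc (f x * (t / 2 * deriv g x)) ^ 2 = (t ^ 2 / 4 * f x ^ 2) * deriv g x ^ 2 := by ring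
      _ ≤ _ := mul_le_of_le_one_right (by positivity) this
  have hdint : Integrable (fun x => deriv f x ^ 2) ν := by
    refine (hf2int.const_mul (t ^ 2 / 4)).mono'
      ((measurable_deriv f).pow_const 2).aestronglyMeasurable (ae_of_all _ fun x => ?_)
    rw [norm_of_nonneg (sq_nonneg _)]
    exact hle x
  obtain ⟨-, h2⟩ := h f hfdiff hone hdint
  have h3 : ∫ x, deriv f x ^ 2 ∂ν ≤ t ^ 2 / 4 := by
    refine (integral_mono hdint (hf2int.const_mul (t ^ 2 / 4)) hle).trans_eq ?_
    rw [integral_const_mul, hone, mul_one]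
  have hset : integrableExpSet g ν = Set.univ := Set.eq_univ_of_forall hint
  have h4 : ∫ x, f x ^ 2 * Real.log (f x ^ 2) ∂ν = t * deriv (cgf g ν) t - cgf g ν t := by
    have e : ∀ x, f x ^ 2 * Real.log (f x ^ 2) =
        t * ((g x * exp (t * g x)) / Z) - Real.log Z * f x ^ 2 := by
      intro x
      rw [hf2, log_div (exp_pos _).ne' hZ.ne', log_exp]
      ring
    have hgint : Integrable (fun x => g x * exp (t * g x)) ν :=
      (hint t).bdd_mul (c := B) hg.continuous.aestronglyMeasurable (ae_of_all _ hB)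
    simp only [e]
    rw [integral_sub ((hgint.div_const Z).const_mul t) (hf2int.const_mul _),
      integral_const_mul, integral_const_mul, hone, integral_div,
      deriv_cgf (by rw [hset]; simp), mul_one]
    rfl
  rw [h4] at h2
  calc _ ≤ _ := h2
    _ ≤ 2 * K * (t ^ 2 / 4) := by gcongr
    _ = _ := by ring

/-- Dividing the differential inequality by `t²` shows that `cgf(t)/t - K t/2` is nonincreasing for
`t > 0`. Its limit at `0+` is the mean. -/
theorem LogSobolev.cgf_le_of_bounded (h : LogSobolev ν K) (hK : 0 ≤ K)
    (hg : Differentiable ℝ g) (hB : ∀ x, |g x| ≤ B) (hg' : ∀ x, |deriv g x| ≤ 1) {t : ℝ}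
    (ht : 0 < t) :
    cgf g ν t ≤ t * ∫ x, g x ∂ν + K * t ^ 2 / 2 := by
  have hint := integrable_exp_mul_of_bounded (ν := ν) hg.continuous.measurable hB
  have hset : integrableExpSet g ν = Set.univ := Set.eq_univ_of_forall hint
  have hmem : ∀ s : ℝ, s ∈ interior (integrableExpSet g ν) := by simp [hset]
  have hd : ∀ s, HasDerivAt (cgf g ν) (deriv (cgf g ν) s) s := fun s =>
    (analyticAt_cgf (hmem s)).differentiableAt.hasDerivAt
  have hψ : ∀ s : ℝ, 0 < s → HasDerivAt (fun s => cgf g ν s / s - K * s / 2)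
      ((deriv (cgf g ν) s * s - cgf g ν s * 1) / s ^ 2 - K * 1 / 2) s := fun s hs =>
    ((hd s).div (hasDerivAt_id s) hs.ne').sub (((hasDerivAt_id s).const_mul K).div_const 2)
  have hanti : AntitoneOn (fun s => cgf g ν s / s - K * s / 2) (Set.Ioi 0) := by
    refine antitoneOn_of_deriv_nonpos (convex_Ioi 0)
      (fun s hs => (hψ s hs).continuousAt.continuousWithinAt) ?_ ?_
    · rw [interior_Ioi]
      exact fun s hs => (hψ s hs).differentiableAt.differentiableWithinAt
    · rw [interior_Ioi]
      intro s hs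
      have hs' : 0 < s := hs
      rw [(hψ s hs).deriv, sub_nonpos, div_le_iff₀ (by positivity)]
      linarith [h.mul_deriv_cgf_sub_cgf_le hK hg hB hg' s]
  have hlim : Tendsto (fun s => cgf g ν s / s - K * s / 2) (𝓝[>] 0) (𝓝 (∫ x, g x ∂ν)) := by
    have h1 := (hasDerivAt_iff_tendsto_slope.1 (hd 0)).mono_left
      (nhdsWithin_mono 0 (fun s (hs : 0 < s) => hs.ne' : Set.Ioi (0 : ℝ) ⊆ {0}ᶜ))
    rw [deriv_cgf_zero (hmem 0), probReal_univ, div_one] at h1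
    have h2 : Tendsto (fun s : ℝ => K * s / 2) (𝓝[>] 0) (𝓝 0) := by
      have : Continuous fun s : ℝ => K * s / 2 := by fun_prop
      simpa using (this.tendsto 0).mono_left nhdsWithin_le_nhds
    have h3 := h1.sub h2
    rw [sub_zero] at h3
    refine h3.congr fun s => ?_
    rw [slope_def_field, cgf_zero]
    simp
  have hle : cgf g ν t / t - K * t / 2 ≤ ∫ x, g x ∂ν := by
    refine ge_of_tendsto hlim ?_
    filter_upwards [Ioc_mem_nhdsGT ht] with s hs
    exact hanti hs.1 ht hs.2
  have : cgf g ν t / t ≤ ∫ x, g x ∂ν + K * t / 2 := by linarith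
  rw [div_le_iff₀ ht] at this
  linarith

theorem LogSobolev.mgf_le_of_bounded (h : LogSobolev ν K) (hK : 0 ≤ K)
    (hg : Differentiable ℝ g) (hB : ∀ x, |g x| ≤ B) (hg' : ∀ x, |deriv g x| ≤ 1) (t : ℝ) :
    mgf g ν t ≤ exp (t * ∫ x, g x ∂ν + K * t ^ 2 / 2) := by
  have pos : ∀ {g : ℝ → ℝ}, Differentiable ℝ g → (∀ x, |g x| ≤ B) → (∀ x, |deriv g x| ≤ 1) →
      ∀ {t : ℝ}, 0 < t → mgf g ν t ≤ exp (t * ∫ x, g x ∂ν + K * t ^ 2 / 2) := by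
    intro g hg hB hg' t ht
    rw [← exp_cgf (integrable_exp_mul_of_bounded hg.continuous.measurable hB t), exp_le_exp]
    exact h.cgf_le_of_bounded hK hg hB hg' ht
  rcases lt_trichotomy t 0 with ht | rfl | ht
  · have := pos (g := -g) hg.neg (by simpa using hB) (by simpa [deriv.neg'] using hg')
      (neg_pos.2 ht)
    rw [mgf_neg, neg_neg] at this
    refine this.trans_eq ?_
    simp only [Pi.neg_apply, integral_neg]
    congr 1
    ring
  · simp
  · exact pos hg hB hg' ht

/-- Exponential integrability of the identity is not known beforehand, so it is approximated by
bounded functions and Fatou's lemma passes to the limit. -/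
theorem LogSobolev.lintegral_exp_le (h : LogSobolev ν K) (hK : 0 ≤ K)
    (hi : Integrable (fun x => x) ν) (h0 : ∫ x, x ∂ν = 0) (t : ℝ) :
    ∫⁻ x, ENNReal.ofReal (exp (t * x)) ∂ν ≤ ENNReal.ofReal (exp (K * t ^ 2 / 2)) := by
  -- A smooth truncation: bounded, everywhere differentiable and `1`-Lipschitz, with `g n x → x` and
  -- `|g n x| ≤ |x|`.
  let g : ℕ → ℝ → ℝ := fun n x => (n + 1 : ℝ) * arctan (x / (n + 1))
  have hn : ∀ n : ℕ, (0 : ℝ) < n + 1 := fun n => by positivity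
  have hgd : ∀ n x, HasDerivAt (g n) (1 / (1 + (x / (n + 1)) ^ 2)) x := by
    intro n x
    have := ((((hasDerivAt_id x).div_const (n + 1 : ℝ)).arctan).const_mul (n + 1 : ℝ))
    refine this.congr_deriv ?_
    have := (hn n).ne'
    simp only [id]
    field_simp
  have hg : ∀ n, Differentiable ℝ (g n) := fun n x => (hgd n x).differentiableAt
  have hg' : ∀ n x, |deriv (g n) x| ≤ 1 := by
    intro n x
    rw [(hgd n x).deriv, abs_of_pos (by positivity), div_le_one (by positivity)]
    linarith [sq_nonneg (x / (n + 1))]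
  have hB : ∀ n x, |g n x| ≤ (n + 1) * (π / 2) := by
    intro n x
    simp only [g]
    rw [abs_mul, abs_of_pos (hn n)]
    refine mul_le_mul_of_nonneg_left ?_ (hn n).le
    rw [abs_le]
    exact ⟨(neg_pi_div_two_lt_arctan _).le, (arctan_lt_pi_div_two _).le⟩
  have hgx : ∀ n x, ‖g n x‖ ≤ |x| := by
    intro n x
    have := Convex.norm_image_sub_le_of_norm_deriv_le (f := g n) (C := 1) (s := Set.univ)
      (fun x _ => (hg n) x) (fun x _ => hg' n x) convex_univ (Set.mem_univ 0) (Set.mem_univ x)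
    simpa [g] using this
  have hlim : ∀ x, Tendsto (fun n => g n x) atTop (𝓝 x) := by
    intro x
    have h1 : HasDerivAt (fun s => arctan (x * s)) x 0 := by
      have := ((hasDerivAt_id (0 : ℝ)).const_mul x).arctan
      simpa using this
    have h2 := (hasDerivAt_iff_tendsto_slope.1 h1).comp
      (f := fun n : ℕ => 1 / ((n : ℝ) + 1)) (x := atTop) (tendsto_nhdsWithin_iff.2
        ⟨tendsto_one_div_add_atTop_nhds_zero_nat, .of_forall fun n => by
          simpa using (hn n).ne'⟩)
    refine h2.congr fun n => ?_
    simp only [Function.comp, slope_def_field, g]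
    have := (hn n).ne'
    simp
    field_simp
  have hmean : Tendsto (fun n => ∫ x, g n x ∂ν) atTop (𝓝 0) := by
    rw [← h0]
    exact tendsto_integral_of_dominated_convergence (fun x => |x|)
      (fun n => (hg n).continuous.aestronglyMeasurable) hi.abs
      (fun n => ae_of_all _ (hgx n)) (ae_of_all _ hlim)
  have hmgf : ∀ n, ∫⁻ x, ENNReal.ofReal (exp (t * g n x)) ∂ν ≤
      ENNReal.ofReal (exp (t * ∫ x, g n x ∂ν + K * t ^ 2 / 2)) := by
    intro n
    rw [← ofReal_integral_eq_lintegral_ofReal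
      (integrable_exp_mul_of_bounded (hg n).continuous.measurable (hB n) t)
      (ae_of_all _ fun x => (exp_pos _).le)]
    exact ENNReal.ofReal_le_ofReal (h.mgf_le_of_bounded hK (hg n) (hB n) (hg' n) t)
  have hR : Tendsto (fun n => ENNReal.ofReal (exp (t * ∫ x, g n x ∂ν + K * t ^ 2 / 2))) atTop
      (𝓝 (ENNReal.ofReal (exp (K * t ^ 2 / 2)))) := by
    have := (hmean.const_mul t).add_const (K * t ^ 2 / 2)
    rw [mul_zero, zero_add] at this
    exact ENNReal.tendsto_ofReal ((continuous_exp.tendsto _).comp this)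
  calc ∫⁻ x, ENNReal.ofReal (exp (t * x)) ∂ν
      = ∫⁻ x, liminf (fun n => ENNReal.ofReal (exp (t * g n x))) atTop ∂ν := by
        refine lintegral_congr fun x => (Tendsto.liminf_eq ?_).symm
        exact ENNReal.tendsto_ofReal ((continuous_exp.tendsto _).comp ((hlim x).const_mul t))
    _ ≤ liminf (fun n => ∫⁻ x, ENNReal.ofReal (exp (t * g n x)) ∂ν) atTop :=
        lintegral_liminf_le fun n => by
          have := (hg n).continuous.measurable
          fun_prop
    _ ≤ liminf (fun n => ENNReal.ofReal (exp (t * ∫ x, g n x ∂ν + K * t ^ 2 / 2))) atTop :=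
        liminf_le_liminf (.of_forall hmgf)
    _ = _ := hR.liminf_eq

/-- **Herbst's argument.** -/
theorem LogSobolev.hasSubgaussianMGF (h : LogSobolev ν K) (hK : 0 ≤ K)
    (hi : Integrable (fun x => x) ν) (h0 : ∫ x, x ∂ν = 0) :
    HasSubgaussianMGF (fun x => x) K.toNNReal ν := by
  have hle := h.lintegral_exp_le hK hi h0
  have hint : ∀ t, Integrable (fun x => exp (t * x)) ν := fun t =>
    ⟨by fun_prop, (hasFiniteIntegral_iff_ofReal (ae_of_all _ fun x => (exp_pos _).le)).2
      ((hle t).trans_lt ENNReal.ofReal_lt_top)⟩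
  refine ⟨hint, fun t => ?_⟩
  rw [Real.coe_toNNReal _ hK, mgf,
    integral_eq_lintegral_of_nonneg_ae (ae_of_all _ fun x => (exp_pos _).le) (by fun_prop)]
  exact ENNReal.toReal_le_of_le_ofReal (exp_pos _).le (hle t)

end Herbst

end SpinGlass

namespace SpinGlass

/-! ### The disorder tensor and its norm -/

section SpinForm

variable {N p : ℕ} (J : (Fin p → Fin N) → ℝ)

/-- The multilinear form `∑ J_{i_1, …, i_p} x^1_{i_1} ⋯ x^p_{i_p}`. -/
noncomputable def spinForm : ContinuousMultilinearMap ℝ (fun _ : Fin p => Vec N) ℝ :=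
  ∑ idx : Fin p → Fin N, J idx •
    (ContinuousMultilinearMap.mkPiAlgebra ℝ (Fin p) ℝ).compContinuousLinearMap
      fun k => (EuclideanSpace.proj (idx k) : Vec N →L[ℝ] ℝ)

/-- The injective norm of the symmetrized disorder tensor. -/
noncomputable def spinNorm : ℝ := ‖symmetrization (spinForm J)‖

theorem spinNorm_nonneg : 0 ≤ spinNorm J := norm_nonneg _

theorem spinForm_diagonal (x : Vec N) :
    spinForm J (fun _ => x) = ∑ idx : Fin p → Fin N, J idx * mono idx x := by
  simp [spinForm, mono]

theorem pureH_eq_symmetrization (x : Vec N) :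
    pureH p J x = scale N p * symmetrization (spinForm J) (fun _ => x) := by
  rw [pureH, symmetrization_diagonal, spinForm_diagonal]

theorem scale_nonneg (N p : ℕ) : 0 ≤ scale N p := by
  unfold scale; positivity

theorem contDiff_diagonal {E : Type*} [NormedAddCommGroup E] [NormedSpace ℝ E]
    (f : ContinuousMultilinearMap ℝ (fun _ : Fin p => E) ℝ) {n : WithTop ℕ∞} :
    ContDiff ℝ n fun x => f fun _ => x :=
  f.contDiff.comp (contDiff_pi.2 fun _ => contDiff_id)

theorem contDiff_pureH {n : WithTop ℕ∞} : ContDiff ℝ n (pureH p J) := by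
  have : pureH p J = fun x => scale N p * symmetrization (spinForm J) (fun _ => x) :=
    funext (pureH_eq_symmetrization J)
  rw [this]
  exact contDiff_const.mul (contDiff_diagonal _)

theorem norm_iteratedFDeriv_pureH_le (n : ℕ) (x : Vec N) :
    ‖iteratedFDeriv ℝ n (pureH p J) x‖ ≤
      scale N p * (p.descFactorial n * spinNorm J * ‖x‖ ^ (p - n)) := by
  have : pureH p J = scale N p • fun x : Vec N => symmetrization (spinForm J) (fun _ => x) :=
    funext (pureH_eq_symmetrization J)
  rw [this, iteratedFDeriv_const_smul_apply (contDiff_diagonal _).contDiffAt, norm_smul,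
    Real.norm_of_nonneg (scale_nonneg N p)]
  exact mul_le_mul_of_nonneg_left (norm_iteratedFDeriv_diagonal_le _ n x) (scale_nonneg N p)

/-- Diagonal values of a `p`-linear form `S` vary by at most `p ‖S‖ ε` between unit-ball points at
distance `ε`. Banach's theorem makes `‖S‖` one of these values up to sign, and symmetrization leaves
them unchanged. -/
theorem spinNorm_le_of_net {ε b : ℝ} (hN : 1 ≤ N) (S : Finset (Vec N)) (hS : ∀ c ∈ S, ‖c‖ ≤ 1)
    (hcov : ∀ x : Vec N, ‖x‖ ≤ 1 → ∃ c ∈ S, ‖x - c‖ ≤ ε)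
    (hb : ∀ c ∈ S, |∑ idx : Fin p → Fin N, J idx * mono idx c| < b) :
    spinNorm J * (1 - p * ε) < b := by
  have : Nontrivial (Vec N) := by
    have : Nonempty (Fin N) := ⟨⟨0, hN⟩⟩
    infer_instance
  obtain ⟨x, hx, hxn⟩ := exists_diagonal_eq_norm_symmetrization (spinForm J)
  obtain ⟨c, hc, hxc⟩ := hcov x hx.le
  have h1 := (symmetrization (spinForm J)).norm_image_sub_le (fun _ => x) (fun _ => c)
  have e1 : ‖(fun _ => x : Fin p → Vec N)‖ ≤ 1 :=
    (pi_norm_le_iff_of_nonneg zero_le_one).2 fun _ => hx.le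
  have e2 : ‖(fun _ => c : Fin p → Vec N)‖ ≤ 1 :=
    (pi_norm_le_iff_of_nonneg zero_le_one).2 fun _ => hS c hc
  have e3 : ‖(fun _ => x : Fin p → Vec N) - fun _ => c‖ ≤ ε :=
    (pi_norm_le_iff_of_nonneg ((norm_nonneg _).trans hxc)).2 fun _ => hxc
  rw [symmetrization_diagonal, symmetrization_diagonal, Fintype.card_fin] at h1
  have h2 : ‖(spinForm J fun _ => x) - spinForm J fun _ => c‖ ≤ spinNorm J * p * ε := by
    refine h1.trans ?_
    calc _ ≤ ‖symmetrization (spinForm J)‖ * p * 1 ^ (p - 1) * ε := by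
          gcongr
          exact max_le e1 e2
      _ = _ := by rw [one_pow, mul_one, spinNorm]
  have h3 := hb c hc
  rw [← spinForm_diagonal] at h3
  have h4 := (abs_sub_abs_le_abs_sub _ _).trans h2
  rw [hxn] at h4
  change spinNorm J - _ ≤ _ at h4
  linarith

theorem sum_mono_sq (x : Vec N) : ∑ idx : Fin p → Fin N, mono idx x ^ 2 = ‖x‖ ^ (2 * p) := by
  have : (∑ i, x i ^ 2) ^ p = ∏ _k : Fin p, ∑ i, x i ^ 2 := by simp
  rw [pow_mul, EuclideanSpace.real_norm_sq_eq, this, Finset.prod_univ_sum, Fintype.piFinset_univ]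
  simp [mono, Finset.prod_pow]

end SpinForm

theorem _root_.ProbabilityTheory.HasSubgaussianMGF.mono {Ω : Type*} {mΩ : MeasurableSpace Ω}
    {μ : Measure Ω} {X : Ω → ℝ} {c d : NNReal} (h : HasSubgaussianMGF X c μ) (hcd : c ≤ d) :
    HasSubgaussianMGF X d μ :=
  ⟨h.integrable_exp_mul, fun t => (h.mgf_le t).trans (by gcongr)⟩

/-! ### Tail of the tensor norm -/

section Tail

variable {N : ℕ} {Ω : Type*} [MeasurableSpace Ω] {P : Measure Ω} [IsProbabilityMeasure P]
  {K : ℝ} {J : (p : ℕ) → (Fin p → Fin N) → Ω → ℝ}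

theorem IsDisorder.integrable (h : IsDisorder P K J) {p : ℕ} (hp : 2 ≤ p) (idx : Fin p → Fin N) :
    Integrable (J p idx) P := by
  have hm : AEStronglyMeasurable (J p idx) P := (h.measurable p hp idx).aestronglyMeasurable
  -- A variable outside `L²` has `variance` equal to `0` by convention, so variance `1` yields
  -- integrability. The mean condition alone would not, since a non-integrable function has integral
  -- `0`.
  have : MemLp (J p idx) 2 P := by
    by_contra hc
    have := h.var p hp idx
    rw [variance, evariance_eq_top hm hc] at this
    simp at this
  exact this.integrable one_le_two

theorem IsDisorder.hasSubgaussianMGF (h : IsDisorder P K J) (hK : 0 ≤ K) {p : ℕ} (hp : 2 ≤ p)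
    (idx : Fin p → Fin N) : HasSubgaussianMGF (J p idx) K.toNNReal P := by
  have hm := (h.measurable p hp idx).aemeasurable (μ := P)
  have : IsProbabilityMeasure (P.map (J p idx)) := Measure.isProbabilityMeasure_map hm
  refine HasSubgaussianMGF.of_map (X := fun x => x) hm
    ((h.logSobolev p hp idx).hasSubgaussianMGF hK ?_ ?_)
  · exact (integrable_map_measure (g := fun x => x) (by fun_prop) hm).2 (h.integrable hp idx)
  · rw [integral_map hm (by fun_prop)]
    exact h.mean p hp idx

/-- Independence adds the proxies to `K * ∑ mono² = K ‖x‖^(2p)`, which is at most `K`. -/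
theorem IsDisorder.hasSubgaussianMGF_sum (h : IsDisorder P K J) (hK : 0 ≤ K) {p : ℕ} (hp : 2 ≤ p)
    {x : Vec N} (hx : ‖x‖ ≤ 1) :
    HasSubgaussianMGF (fun ω => ∑ idx : Fin p → Fin N, J p idx ω * mono idx x) K.toNNReal P := by
  have hind : iIndepFun (fun (idx : Fin p → Fin N) => J p idx) P :=
    h.indep.precomp (g := fun idx : Fin p → Fin N => (⟨⟨p, hp⟩, idx⟩ : DisorderIndex N))
      (fun a b hab => by simpa using hab)
  have hind' : iIndepFun (fun (idx : Fin p → Fin N) ω => mono idx x * J p idx ω) P :=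
    hind.comp (fun idx y => mono idx x * y) (fun idx => by fun_prop)
  have := HasSubgaussianMGF.sum_of_iIndepFun hind' (s := Finset.univ)
    (fun idx _ => (h.hasSubgaussianMGF hK hp idx).const_mul (mono idx x))
  simp only [mul_comm (mono _ x)] at this
  refine this.mono ?_
  rw [← NNReal.coe_le_coe, NNReal.coe_sum]
  change ∑ idx : Fin p → Fin N, mono idx x ^ 2 * (K.toNNReal : ℝ) ≤ _
  rw [← Finset.sum_mul, sum_mono_sq]
  refine mul_le_of_le_one_left (NNReal.coe_nonneg _) ?_
  exact pow_le_one₀ (norm_nonneg _) hx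

theorem HasSubgaussianMGF.measure_abs_ge_le {X : Ω → ℝ} {c : NNReal}
    (h : HasSubgaussianMGF X c P) {t : ℝ} (ht : 0 ≤ t) :
    P {ω | t ≤ |X ω|} ≤ ENNReal.ofReal (2 * Real.exp (-t ^ 2 / (2 * c))) := by
  have h1 := h.measure_ge_le ht
  have h2 := h.neg.measure_ge_le ht
  have hsub : {ω | t ≤ |X ω|} ⊆ {ω | t ≤ X ω} ∪ {ω | t ≤ (-X) ω} := 
    fun ω hω => (le_abs.1 hω : t ≤ X ω ∨ t ≤ -X ω)
  refine (measure_mono hsub).trans ((measure_union_le _ _).trans ?_)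
  rw [two_mul, ENNReal.ofReal_add (Real.exp_pos _).le (Real.exp_pos _).le]
  refine add_le_add ?_ ?_
  · rw [← ofReal_measureReal]; exact ENNReal.ofReal_le_ofReal h1
  · rw [← ofReal_measureReal]; exact ENNReal.ofReal_le_ofReal h2

theorem IsDisorder.measure_spinNorm_ge_le (h : IsDisorder P K J) (hK : 0 < K) (hN : 1 ≤ N)
    {p : ℕ} (hp : 2 ≤ p) :
    P {ω | 2 * 4 * √(K * p) * √(N : ℝ) ≤ spinNorm (fun idx => J p idx ω)} ≤
      ENNReal.ofReal (Real.exp (-((4 : ℝ) ^ 2 * p / 2) * N)) := by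
  have hp2 : (2 : ℝ) ≤ p := by exact_mod_cast hp
  have hN1 : (1 : ℝ) ≤ N := by exact_mod_cast hN
  have hε : (0 : ℝ) < 1 / (4 * p) := by positivity
  obtain ⟨S, hS, hcov, hcard⟩ := exists_net_unit_ball (Vec N) hε
  rw [finrank_euclideanSpace_fin] at hcard
  -- With mesh `1/(4p)` the net loses the factor `3/4`, and `6 = 8 * 3/4`. The tail at level `b` is
  -- then `2 exp(-18 p N)`.
  set b : ℝ := 6 * √(K * p) * √(N : ℝ) with hb
  have hsub : {ω | 2 * 4 * √(K * p) * √(N : ℝ) ≤ spinNorm (fun idx => J p idx ω)} ⊆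
      ⋃ c ∈ S, {ω | b ≤ |∑ idx : Fin p → Fin N, J p idx ω * mono idx c|} := by
    intro ω hω
    by_contra hcon
    simp only [Set.mem_iUnion, Set.mem_ofPred_eq, not_exists, not_le] at hcon hω
    have := spinNorm_le_of_net (fun idx => J p idx ω) hN S hS hcov hcon
    have e : (1 : ℝ) - p * (1 / (4 * p)) = 3 / 4 := by field_simp; norm_num
    rw [e, hb] at this
    linarith
  have hexp : -b ^ 2 / (2 * (K.toNNReal : ℝ)) = -(18 * p * N) := by
    rw [Real.coe_toNNReal _ hK.le, hb, mul_pow, mul_pow, Real.sq_sqrt (by positivity),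
      Real.sq_sqrt (by positivity)]
    field_simp
    norm_num
  have hone : ∀ c ∈ S, P {ω | b ≤ |∑ idx : Fin p → Fin N, J p idx ω * mono idx c|} ≤
      ENNReal.ofReal (2 * Real.exp (-(18 * p * N))) := by
    intro c hc
    rw [← hexp]
    exact HasSubgaussianMGF.measure_abs_ge_le (h.hasSubgaussianMGF_sum hK.le hp (hS c hc))
      (by positivity)
  refine (measure_mono hsub).trans ((measure_biUnion_finset_le _ _).trans
    ((Finset.sum_le_sum hone).trans ?_))
  rw [Finset.sum_const, nsmul_eq_mul, ← ENNReal.ofReal_natCast,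
    ← ENNReal.ofReal_mul (Nat.cast_nonneg _)]
  refine ENNReal.ofReal_le_ofReal ?_
  -- Here `exp(10 p N)` pays for both the net and the factor `2`, leaving `exp(-8 p N)`, the claimed
  -- rate with `C = 4`.
  have hbase : 2 * (1 + 2 / (1 / (4 * (p : ℝ)))) ≤ Real.exp (10 * p) := by
    have := Real.quadratic_le_exp_of_nonneg (show (0 : ℝ) ≤ 10 * p by positivity)
    rw [div_div_eq_mul_div, div_one]
    nlinarith
  have h2N : (2 : ℝ) ≤ 2 ^ N := by
    simpa using pow_le_pow_right₀ (one_le_two : (1 : ℝ) ≤ 2) hN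
  calc (S.card : ℝ) * (2 * Real.exp (-(18 * p * N)))
      ≤ (1 + 2 / (1 / (4 * (p : ℝ)))) ^ N * (2 ^ N * Real.exp (-(18 * p * N))) := by gcongr
    _ = (2 * (1 + 2 / (1 / (4 * (p : ℝ))))) ^ N * Real.exp (-(18 * p * N)) := by
        rw [mul_pow]; ring
    _ ≤ Real.exp (10 * p) ^ N * Real.exp (-(18 * p * N)) := by gcongr
    _ = Real.exp (-((4 : ℝ) ^ 2 * p / 2) * N) := by
        rw [← Real.exp_nat_mul, ← Real.exp_add]
        congr 1
        ring

end Tail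

end SpinGlass

namespace SpinGlass

/-! ### From coordinate derivatives to multilinear norms -/

section Coordinates

variable {N : ℕ}

theorem multilinear_eq_sum_single {i : ℕ}
    (L : ContinuousMultilinearMap ℝ (fun _ : Fin i => Vec N) ℝ) (u : Fin i → Vec N) :
    L u = ∑ j : Fin i → Fin N,
      (∏ a, u a (j a)) * L fun a => EuclideanSpace.single (j a) (1 : ℝ) := by
  have hu : u = fun a => ∑ j : Fin N, u a j • EuclideanSpace.single j (1 : ℝ) := by
    ext a k
    simp [Pi.single_apply]
  conv_lhs => rw [hu, L.map_sum]
  simp only [L.map_smul_univ, smul_eq_mul]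

theorem opNorm_of_bilinear_le (L : ContinuousMultilinearMap ℝ (fun _ : Fin 2 => Vec N) ℝ) :
    opNorm (Matrix.of fun j k => L fun a => EuclideanSpace.single (![j, k] a) (1 : ℝ)) ≤ ‖L‖ := by
  set A : Matrix (Fin N) (Fin N) ℝ :=
    Matrix.of fun j k => L fun a => EuclideanSpace.single (![j, k] a) (1 : ℝ) with hA
  have hbil : ∀ w v : Vec N, inner ℝ w (Matrix.toEuclideanCLM (𝕜 := ℝ) (n := Fin N) A v) =
      L ![w, v] := by
    intro w v
    rw [multilinear_eq_sum_single, ← (finTwoArrowEquiv (Fin N)).symm.sum_comp,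
      Fintype.sum_prod_type]
    simp only [finTwoArrowEquiv_symm_apply, Fin.prod_univ_two, PiLp.inner_apply,
      Matrix.ofLp_toEuclideanCLM, Matrix.mulVec, dotProduct, hA, Matrix.of_apply]
    refine Finset.sum_congr rfl fun j _ => ?_
    simp only [RCLike.inner_apply, conj_trivial, Finset.sum_mul]
    refine Finset.sum_congr rfl fun k _ => ?_
    simp
    ring
  refine ContinuousLinearMap.opNorm_le_bound _ (norm_nonneg _) fun v => ?_
  set y := Matrix.toEuclideanCLM (𝕜 := ℝ) (n := Fin N) A v with hy
  -- Test the bilinear form on `w = A v`, so that `‖A v‖² = L(A v, v)`.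
  have h1 : ‖y‖ * ‖y‖ ≤ (‖L‖ * ‖v‖) * ‖y‖ := by
    rw [← real_inner_self_eq_norm_mul_norm]
    conv_lhs => rw [hy]
    rw [← hy, hbil]
    refine (le_abs_self _).trans ((L.le_opNorm _).trans_eq ?_)
    simp [Fin.prod_univ_two]
    ring
  rcases (norm_nonneg y).eq_or_lt with h0 | h0
  · rw [← h0]; positivity
  · exact le_of_mul_le_mul_right h1 h0

end Coordinates

section PureDerivatives

variable {N p : ℕ} (J : (Fin p → Fin N) → ℝ)

theorem contDiff_mono (idx : Fin p → Fin N) {n : WithTop ℕ∞} :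
    ContDiff ℝ n (mono idx : Vec N → ℝ) := by
  unfold mono
  fun_prop

theorem iteratedFDeriv_pureH_apply (i : ℕ) (x : Vec N) (u : Fin i → Vec N) :
    iteratedFDeriv ℝ i (pureH p J) x u =
      scale N p * ∑ idx : Fin p → Fin N, J idx * iteratedFDeriv ℝ i (mono idx) x u := by
  have h1 : pureH p J = scale N p • fun x => ∑ idx : Fin p → Fin N, (J idx • mono idx) x := rfl
  have h2 : ∀ idx : Fin p → Fin N, ContDiff ℝ i (J idx • (mono idx : Vec N → ℝ)) := fun idx =>
    contDiff_const.smul (contDiff_mono idx)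
  rw [h1, iteratedFDeriv_const_smul_apply (ContDiff.sum fun idx _ => h2 idx).contDiffAt,
    iteratedFDeriv_sum fun idx _ => h2 idx]
  simp only [smul_apply, smul_eq_mul, Finset.sum_apply]
  rw [sum_apply]
  congr 1
  refine Finset.sum_congr rfl fun idx _ => ?_
  rw [iteratedFDeriv_const_smul_apply (contDiff_mono idx).contDiffAt]
  simp

theorem pureDir_eq_iteratedFDeriv (i : ℕ) (v x : Vec N) :
    pureDir p J i v x = iteratedFDeriv ℝ i (pureH p J) x fun _ => v := by
  rw [multilinear_eq_sum_single, pureDir, Finset.mul_sum]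
  refine Finset.sum_congr rfl fun j _ => ?_
  rw [iteratedFDeriv_pureH_apply]
  simp only [partialD]
  ring

theorem pureHess_eq_iteratedFDeriv (x : Vec N) :
    pureHess p J x = Matrix.of fun j k => iteratedFDeriv ℝ 2 (pureH p J) x
      fun a => EuclideanSpace.single (![j, k] a) (1 : ℝ) := by
  ext j k
  simp only [pureHess, Matrix.of_apply, iteratedFDeriv_pureH_apply, partialD]

theorem scale_mul_sqrt_pow (hN : 1 ≤ N) {n : ℕ} (hn : n ≤ p) :
    scale N p * √(N : ℝ) ^ (p - n) = (N : ℝ) ^ ((1 - (n : ℝ)) / 2) := by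
  have hN0 : (0 : ℝ) < N := by exact_mod_cast hN
  rw [scale, Real.sqrt_eq_rpow, ← Real.rpow_natCast, ← Real.rpow_mul hN0.le, one_div,
    ← Real.rpow_neg hN0.le, ← Real.rpow_add hN0, Nat.cast_sub hn]
  congr 1
  ring

/-- The room `s > 1` serves the mixed model, where smoothness at the boundary of `ball N` needs
bounds on a larger ball. -/
theorem norm_iteratedFDeriv_pureH_le_of_norm_le (hN : 1 ≤ N) (n : ℕ) {s : ℝ} (hs : 1 ≤ s)
    {x : Vec N} (hx : ‖x‖ ≤ s * √(N : ℝ)) :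
    ‖iteratedFDeriv ℝ n (pureH p J) x‖ ≤
      s ^ p * (p.descFactorial n * spinNorm J * (N : ℝ) ^ ((1 - (n : ℝ)) / 2)) := by
  refine (norm_iteratedFDeriv_pureH_le J n x).trans ?_
  have h0 := spinNorm_nonneg J
  rcases le_or_gt n p with hn | hn
  · rw [← scale_mul_sqrt_pow hN hn]
    have h1 : ‖x‖ ^ (p - n) ≤ s ^ p * √(N : ℝ) ^ (p - n) := by
      refine (pow_le_pow_left₀ (norm_nonneg _) hx _).trans ?_
      rw [mul_pow]
      gcongr
      exact Nat.sub_le p n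
    have := scale_nonneg N p
    calc _ ≤ scale N p * (p.descFactorial n * spinNorm J * (s ^ p * √(N : ℝ) ^ (p - n))) := by
          gcongr
      _ = _ := by ring
  -- For `n > p` the exponent `p - n` is truncated to `0`, but the factorial factor vanishes.
  · rw [Nat.descFactorial_of_lt hn]
    simp

theorem norm_iteratedFDeriv_pureH_le_of_mem_ball (hN : 1 ≤ N) (n : ℕ) {x : Vec N}
    (hx : x ∈ ball N) :
    ‖iteratedFDeriv ℝ n (pureH p J) x‖ ≤
      p.descFactorial n * spinNorm J * (N : ℝ) ^ ((1 - (n : ℝ)) / 2) := by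
  have := norm_iteratedFDeriv_pureH_le_of_norm_le J hN n le_rfl (x := x) (by rwa [one_mul])
  rwa [one_pow, one_mul] at this

theorem abs_pureDir_le (hN : 1 ≤ N) (i : ℕ) {v x : Vec N} (hv : ‖v‖ = 1) (hx : x ∈ ball N) :
    |pureDir p J i v x| ≤
      p.descFactorial i * spinNorm J * (N : ℝ) ^ ((1 - (i : ℝ)) / 2) := by
  rw [pureDir_eq_iteratedFDeriv]
  refine le_trans ?_ (norm_iteratedFDeriv_pureH_le_of_mem_ball J hN i hx)
  simpa [hv] using (iteratedFDeriv ℝ i (pureH p J) x).le_opNorm fun _ => v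

theorem opNorm_pureHess_le (hN : 1 ≤ N) {x : Vec N} (hx : x ∈ ball N) :
    opNorm (pureHess p J x) ≤
      p.descFactorial 2 * spinNorm J * (N : ℝ) ^ ((1 - ((2 : ℕ) : ℝ)) / 2) := by
  rw [pureHess_eq_iteratedFDeriv]
  exact (opNorm_of_bilinear_le _).trans (norm_iteratedFDeriv_pureH_le_of_mem_ball J hN 2 hx)

theorem norm_iteratedFDeriv_two_pureH_sub_le (hN : 1 ≤ N) {x y : Vec N} (hx : x ∈ ball N)
    (hy : y ∈ ball N) :
    ‖iteratedFDeriv ℝ 2 (pureH p J) x - iteratedFDeriv ℝ 2 (pureH p J) y‖ ≤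
      p.descFactorial 3 * spinNorm J * (N : ℝ) ^ ((1 - ((3 : ℕ) : ℝ)) / 2) * ‖x - y‖ := by
  have hball : ball N = Metric.closedBall 0 √(N : ℝ) := by ext; simp [ball]
  refine Convex.norm_image_sub_le_of_norm_fderiv_le (s := ball N)
    (fun z _ => ((contDiff_pureH J).differentiable_iteratedFDeriv (m := 2) (n := 3)
      (by norm_cast)).differentiableAt) (fun z hz => ?_) ?_ hy hx
  · rw [norm_fderiv_iteratedFDeriv]
    exact norm_iteratedFDeriv_pureH_le_of_mem_ball J hN 3 hz
  · rw [hball]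
    exact convex_closedBall _ _

theorem opNorm_pureHess_sub_le (hN : 1 ≤ N) {x y : Vec N} (hx : x ∈ ball N) (hy : y ∈ ball N) :
    opNorm (pureHess p J x - pureHess p J y) ≤
      p.descFactorial 3 * spinNorm J * (N : ℝ) ^ ((1 - ((3 : ℕ) : ℝ)) / 2) * ‖x - y‖ := by
  rw [pureHess_eq_iteratedFDeriv, pureHess_eq_iteratedFDeriv]
  exact (opNorm_of_bilinear_le (iteratedFDeriv ℝ 2 (pureH p J) x -
    iteratedFDeriv ℝ 2 (pureH p J) y)).trans (norm_iteratedFDeriv_two_pureH_sub_le J hN hx hy)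

end PureDerivatives

theorem le_of_mul_rpow_le {N : ℕ} (hN : 1 ≤ N) {n : ℕ} {a b D : ℝ} (hD : 0 < D)
    (h : a / (N : ℝ) ^ (((n : ℝ) - 2) / 2) * D ≤ D * b * (N : ℝ) ^ ((1 - (n : ℝ)) / 2)) :
    a * √(N : ℝ) ≤ b := by
  have hN0 : (0 : ℝ) < N := by exact_mod_cast hN
  have e : (N : ℝ) ^ ((1 - (n : ℝ)) / 2) = (√(N : ℝ))⁻¹ * ((N : ℝ) ^ (((n : ℝ) - 2) / 2))⁻¹ := by
    rw [Real.sqrt_eq_rpow, ← Real.rpow_neg hN0.le, ← Real.rpow_neg hN0.le, ← Real.rpow_add hN0]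
    congr 1
    ring
  have hr : 0 < (N : ℝ) ^ (((n : ℝ) - 2) / 2) := Real.rpow_pos_of_pos hN0 _
  have hs : 0 < √(N : ℝ) := Real.sqrt_pos.2 hN0
  rw [e] at h
  field_simp at h
  exact h

theorem descFactorial_eq_factorial_div {n p : ℕ} (h : n ≤ p) :
    (p.descFactorial n : ℝ) = (p ! : ℝ) / ((p - n)! : ℝ) := by
  rw [eq_div_iff (by positivity), mul_comm]
  exact_mod_cast Nat.factorial_mul_descFactorial h

/-! ### Pure models -/

section PureBounds

variable {N : ℕ} {Ω : Type*} [MeasurableSpace Ω] {P : Measure Ω} [IsProbabilityMeasure P]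
  {K : ℝ} {J : (p : ℕ) → (Fin p → Fin N) → Ω → ℝ}

/-- Only monotonicity of the outer measure is used, so events quantified over uncountably many
points need no measurability. -/
theorem IsDisorder.measure_le_of_forall (h : IsDisorder P K J) (hK : 0 < K) (hN : 1 ≤ N)
    {p : ℕ} (hp : 2 ≤ p) {A : Set Ω}
    (hA : ∀ ω ∈ A, 2 * 4 * √(K * p) * √(N : ℝ) ≤ spinNorm (fun idx => J p idx ω)) :
    P A ≤ ENNReal.ofReal (Real.exp (-((4 : ℝ) ^ 2 * p / 2) * N)) :=
  (measure_mono hA).trans (h.measure_spinNorm_ge_le hK hN hp)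

theorem IsDisorder.measure_iSup_opNorm_pureHess_ge_le (h : IsDisorder P K J) (hK : 0 < K)
    (hN : 1 ≤ N) {p : ℕ} (hp : 2 ≤ p) :
    P {ω | 2 * 4 * √K * (p : ℝ) ^ (3 / 2 : ℝ) * ((p : ℝ) - 1) ≤
        ⨆ x : ball N, opNorm (pureHess p (fun idx => J p idx ω) (x : Vec N))}
      ≤ ENNReal.ofReal (Real.exp (-((4 : ℝ) ^ 2 * p / 2) * N)) := by
  refine h.measure_le_of_forall hK hN hp fun ω hω => ?_
  have hp0 : (0 : ℝ) < p := by positivity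
  have : Nonempty (ball N) := ⟨⟨0, by simp [ball]⟩⟩
  have h1 := (Set.mem_ofPred_eq ▸ hω : _ ≤ _).trans (ciSup_le fun x : ball N =>
    opNorm_pureHess_le (fun idx => J p idx ω) hN x.2)
  refine le_of_mul_rpow_le hN (n := 2) (D := p.descFactorial 2)
    (by exact_mod_cast Nat.descFactorial_pos.2 hp) (le_trans (le_of_eq ?_) h1)
  rw [Nat.cast_descFactorial_two, Real.sqrt_mul hK.le, show (3 / 2 : ℝ) = 1 + 1 / 2 by norm_num,
    Real.rpow_add hp0, Real.rpow_one, ← Real.sqrt_eq_rpow]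
  norm_num
  ring

theorem IsDisorder.measure_exists_pureDir_ge_le (h : IsDisorder P K J) (hK : 0 < K)
    (hN : 1 ≤ N) {i p : ℕ} (hp : 2 ≤ p) (hip : i ≤ p) :
    P {ω | ∃ x ∈ ball N, ∃ v : Vec N, ‖v‖ = 1 ∧
        2 * 4 * √(K * p) / (N : ℝ) ^ (((i : ℝ) - 2) / 2) * ((p ! : ℝ) / ((p - i)! : ℝ)) ≤
          |pureDir p (fun idx => J p idx ω) i v x|}
      ≤ ENNReal.ofReal (Real.exp (-((4 : ℝ) ^ 2 * p / 2) * N)) := by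
  refine h.measure_le_of_forall hK hN hp ?_
  rintro ω ⟨x, hx, v, hv, hle⟩
  rw [← descFactorial_eq_factorial_div hip] at hle
  exact le_of_mul_rpow_le hN (by exact_mod_cast Nat.descFactorial_pos.2 hip)
    (hle.trans (abs_pureDir_le _ hN i hv hx))

theorem IsDisorder.measure_exists_pureHess_sub_ge_le (h : IsDisorder P K J) (hK : 0 < K)
    (hN : 1 ≤ N) {p : ℕ} (hp : 3 ≤ p) :
    P {ω | ∃ x ∈ ball N, ∃ y ∈ ball N, x ≠ y ∧
        2 * 4 * √(K * p) / √(N : ℝ) * ((p ! : ℝ) / ((p - 3)! : ℝ)) * ‖x - y‖ ≤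
          opNorm (pureHess p (fun idx => J p idx ω) x - pureHess p (fun idx => J p idx ω) y)}
      ≤ ENNReal.ofReal (Real.exp (-((4 : ℝ) ^ 2 * p / 2) * N)) := by
  refine h.measure_le_of_forall hK hN (by omega) ?_
  rintro ω ⟨x, hx, y, hy, hxy, hle⟩
  rw [← descFactorial_eq_factorial_div hp] at hle
  have h1 := le_of_mul_le_mul_right (hle.trans (opNorm_pureHess_sub_le _ hN hx hy))
    (norm_pos_iff.2 (sub_ne_zero.2 hxy))
  refine le_of_mul_rpow_le hN (n := 3) (D := p.descFactorial 3)
    (by exact_mod_cast Nat.descFactorial_pos.2 hp) (le_trans (le_of_eq ?_) h1)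
  rw [Real.sqrt_eq_rpow (N : ℝ)]
  norm_num

end PureBounds

end SpinGlass

namespace SpinGlass

/-! ### Termwise differentiation on an open set -/

section TermwiseDifferentiation

open Topology

variable {E F : Type*} [NormedAddCommGroup E] [NormedSpace ℝ E] [NormedAddCommGroup F]
  [NormedSpace ℝ F] [CompleteSpace F] {f : ℕ → E → F} {v : ℕ → ℕ → ℝ} {U : Set E} {m : ℕ}

theorem hasFDerivAt_tsum_iteratedFDeriv (hU : IsOpen U) (hU' : IsPreconnected U)
    (hf : ∀ n, ContDiff ℝ m (f n)) (hv : ∀ k ≤ m, Summable (v k))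
    (hb : ∀ k ≤ m, ∀ n, ∀ x ∈ U, ‖iteratedFDeriv ℝ k (f n) x‖ ≤ v k n) {k : ℕ} (hk : k < m)
    {x : E} (hx : x ∈ U) :
    HasFDerivAt (fun y => ∑' n, iteratedFDeriv ℝ k (f n) y)
      (∑' n, fderiv ℝ (iteratedFDeriv ℝ k (f n)) x) x := by
  refine hasFDerivAt_tsum_of_isPreconnected (hv (k + 1) hk) hU hU'
    (fun n y _ => ((hf n).differentiable_iteratedFDeriv
      (by exact_mod_cast hk)).differentiableAt.hasFDerivAt) (fun n y hy => ?_) hx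
    (Summable.of_norm_bounded (hv k hk.le) fun n => hb k hk.le n x hx) hx
  rw [norm_fderiv_iteratedFDeriv]
  exact hb (k + 1) hk n y hy

/-- The majorants are required on `U` only, because those for the mixed Hamiltonian hold only on a
ball. Each induction step differentiates the series of `k`-th derivatives, dominated by `v (k + 1)`.
-/
theorem iteratedFDeriv_tsum_of_isPreconnected (hU : IsOpen U) (hU' : IsPreconnected U)
    (hf : ∀ n, ContDiff ℝ m (f n)) (hv : ∀ k ≤ m, Summable (v k))
    (hb : ∀ k ≤ m, ∀ n, ∀ x ∈ U, ‖iteratedFDeriv ℝ k (f n) x‖ ≤ v k n) {k : ℕ} (hk : k ≤ m)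
    {x : E} (hx : x ∈ U) :
    iteratedFDeriv ℝ k (fun y => ∑' n, f n y) x = ∑' n, iteratedFDeriv ℝ k (f n) x := by
  induction k generalizing x with
  | zero =>
    simp_rw [iteratedFDeriv_zero_eq_comp]
    exact (continuousMultilinearCurryFin0 ℝ E F).symm.toContinuousLinearEquiv.map_tsum
  | succ k IH =>
    have heq : iteratedFDeriv ℝ k (fun y => ∑' n, f n y) =ᶠ[𝓝 x]
        fun y => ∑' n, iteratedFDeriv ℝ k (f n) y := by
      filter_upwards [hU.mem_nhds hx] with y hy using IH (by omega) hy
    simp_rw [iteratedFDeriv_succ_eq_comp_left, Function.comp_apply]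
    rw [heq.fderiv_eq, (hasFDerivAt_tsum_iteratedFDeriv hU hU' hf hv hb hk hx).fderiv]
    exact (continuousMultilinearCurryLeftEquiv ℝ
      (fun _ : Fin (k + 1) => E) F).symm.toContinuousLinearEquiv.map_tsum

theorem contDiffOn_tsum_of_isPreconnected (hU : IsOpen U) (hU' : IsPreconnected U)
    (hf : ∀ n, ContDiff ℝ m (f n)) (hv : ∀ k ≤ m, Summable (v k))
    (hb : ∀ k ≤ m, ∀ n, ∀ x ∈ U, ‖iteratedFDeriv ℝ k (f n) x‖ ≤ v k n) :
    ContDiffOn ℝ m (fun y => ∑' n, f n y) U := by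
  have heq : ∀ k ≤ m, ∀ x ∈ U, iteratedFDerivWithin ℝ k (fun y => ∑' n, f n y) U x =
      ∑' n, iteratedFDeriv ℝ k (f n) x := fun k hk x hx => by
    rw [iteratedFDerivWithin_of_isOpen k hU hx,
      iteratedFDeriv_tsum_of_isPreconnected hU hU' hf hv hb hk hx]
  refine contDiffOn_of_continuousOn_differentiableOn (n := (m : ℕ∞)) (fun k hk => ?_)
    fun k hk => ?_
  · have hk' : k ≤ m := by exact_mod_cast hk
    refine ContinuousOn.congr ?_ (heq k hk')
    exact continuousOn_tsum (fun n => ((hf n).continuous_iteratedFDeriv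
      (by exact_mod_cast hk')).continuousOn) (hv k hk') fun n x hx => hb k hk' n x hx
  · have hk' : k < m := by exact_mod_cast hk
    refine DifferentiableOn.congr ?_ (heq k hk'.le)
    exact fun x hx => (hasFDerivAt_tsum_iteratedFDeriv hU hU' hf hv hb hk'
      hx).differentiableAt.differentiableWithinAt

end TermwiseDifferentiation

theorem summable_multilinear_apply {E : Type*} [NormedAddCommGroup E] [NormedSpace ℝ E] {i : ℕ}
    {L : ℕ → ContinuousMultilinearMap ℝ (fun _ : Fin i => E) ℝ} (hL : Summable L)
    (u : Fin i → E) : Summable (fun n => L n u) ∧ ∑' n, L n u = (∑' n, L n) u := by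
  have h := hL.hasSum.mapL (ContinuousMultilinearMap.apply ℝ (fun _ : Fin i => E) ℝ u)
  exact ⟨h.summable, h.tsum_eq⟩

/-! ### Mixed models for a fixed disorder -/

section MixedDeterministic

variable {N : ℕ} {γ : ℕ → ℝ} {J : (p : ℕ) → (Fin p → Fin N) → ℝ} {s : ℝ}

theorem iteratedFDeriv_smul_pureH {p : ℕ} (c : ℝ) (J : (Fin p → Fin N) → ℝ) (k : ℕ)
    (x : Vec N) :
    iteratedFDeriv ℝ k (c • pureH p J) x = c • iteratedFDeriv ℝ k (pureH p J) x :=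
  iteratedFDeriv_const_smul_apply (contDiff_pureH J).contDiffAt

theorem descFactorial_le_cube {p k : ℕ} (hp : 1 ≤ p) (hk : k ≤ 3) :
    (p.descFactorial k : ℝ) ≤ (p : ℝ) ^ 3 := by
  exact_mod_cast (Nat.descFactorial_le_pow p k).trans (Nat.pow_le_pow_right hp hk)

/-- The cube dominates `p!/(p-k)!` for every `k ≤ 3`, so one summable weight serves all orders. -/
theorem norm_iteratedFDeriv_mixed_term_le (hN : 1 ≤ N) (hs : 1 ≤ s) {k : ℕ} (hk : k ≤ 3) (n : ℕ)
    {x : Vec N} (hx : ‖x‖ ≤ s * √(N : ℝ)) :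
    ‖iteratedFDeriv ℝ k (γ (n + 2) • pureH (n + 2) (J (n + 2))) x‖ ≤
      s ^ (n + 2) * ((n + 2 : ℕ) : ℝ) ^ 3 * |γ (n + 2)| * spinNorm (J (n + 2)) *
        (N : ℝ) ^ ((1 - (k : ℝ)) / 2) := by
  rw [iteratedFDeriv_smul_pureH, norm_smul, Real.norm_eq_abs]
  have h0 := spinNorm_nonneg (J (n + 2))
  calc _ ≤ |γ (n + 2)| * (s ^ (n + 2) * (((n + 2).descFactorial k : ℝ) * spinNorm (J (n + 2)) *
        (N : ℝ) ^ ((1 - (k : ℝ)) / 2))) :=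
        mul_le_mul_of_nonneg_left (norm_iteratedFDeriv_pureH_le_of_norm_le _ hN k hs hx)
          (abs_nonneg _)
    _ ≤ |γ (n + 2)| * (s ^ (n + 2) * ((((n + 2 : ℕ) : ℝ) ^ 3) * spinNorm (J (n + 2)) *
        (N : ℝ) ^ ((1 - (k : ℝ)) / 2))) := by
        gcongr
        exact descFactorial_le_cube (by omega) hk
    _ = _ := by ring

theorem wellDefined_of_summable (hN : 1 ≤ N) (hs : 1 < s)
    (hV : Summable fun n : ℕ => s ^ (n + 2) * ((n + 2 : ℕ) : ℝ) ^ 3 * |γ (n + 2)| *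
      spinNorm (J (n + 2))) : WellDefined γ J := by
  have hN0 : (0 : ℝ) < N := by exact_mod_cast hN
  -- The open ball of radius `s √N` contains the closed ball of radius `√N`, including its boundary
  -- points.
  let U : Set (Vec N) := Metric.ball 0 (s * √(N : ℝ))
  have hU : IsOpen U := Metric.isOpen_ball
  have hU' : IsPreconnected U := (convex_ball _ _).isPreconnected
  have hsub : ∀ x ∈ ball N, x ∈ U := by
    intro x hx
    have hx' : ‖x‖ ≤ √(N : ℝ) := hx
    rw [mem_ball_zero_iff]
    nlinarith [Real.sqrt_pos.2 hN0]
  let f : ℕ → Vec N → ℝ := fun n => γ (n + 2) • pureH (n + 2) (J (n + 2))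
  have hf : ∀ n, ContDiff ℝ (3 : ℕ) (f n) := fun n => contDiff_const.smul (contDiff_pureH _)
  have hv : ∀ k ≤ 3, Summable _ := fun (k : ℕ) _ => hV.mul_right ((N : ℝ) ^ ((1 - (k : ℝ)) / 2))
  have hb : ∀ k ≤ 3, ∀ n, ∀ x ∈ U, ‖iteratedFDeriv ℝ k (f n) x‖ ≤ _ := fun k hk n x hx =>
    norm_iteratedFDeriv_mixed_term_le (J := J) hN hs.le hk n (mem_ball_zero_iff.1 hx).le
  have hH : mixedH γ J = fun y => ∑' n, f n y := rfl
  have hsum : ∀ k ≤ 3, ∀ x ∈ U, Summable fun n => iteratedFDeriv ℝ k (f n) x :=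
    fun k hk x hx => Summable.of_norm_bounded (hv k hk) fun n => hb k hk n x hx
  have happ : ∀ k ≤ 3, ∀ x ∈ U, ∀ u : Fin k → Vec N,
      Summable (fun n => γ (n + 2) * iteratedFDeriv ℝ k (pureH (n + 2) (J (n + 2))) x u) ∧
      ∑' n, γ (n + 2) * iteratedFDeriv ℝ k (pureH (n + 2) (J (n + 2))) x u =
        iteratedFDeriv ℝ k (mixedH γ J) x u := by
    intro k hk x hx u
    have h := summable_multilinear_apply (hsum k hk x hx) u
    rw [hH, iteratedFDeriv_tsum_of_isPreconnected hU hU' hf hv hb hk hx]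
    simpa only [f, iteratedFDeriv_smul_pureH, smul_apply, smul_eq_mul] using h
  intro x hx
  refine ⟨?_, ?_, fun i hi v => ?_, fun j k => ?_⟩
  · simpa using (happ 0 (by norm_num) x (hsub x hx) 0).1
  · exact ((contDiffOn_tsum_of_isPreconnected hU hU' hf hv hb).contDiffAt
      (hU.mem_nhds (hsub x hx)))
  · have hi3 : i ≤ 3 := by
      rcases hi with rfl | rfl | rfl <;> norm_num
    simpa only [mixedDir, pureDir_eq_iteratedFDeriv] using happ i hi3 x (hsub x hx) fun _ => v
  · simpa only [mixedHess, Matrix.of_apply, pureHess_eq_iteratedFDeriv, partialD] using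
      happ 2 (by norm_num) x (hsub x hx) _

/-- The size of the `p`-th term, `p = n + 2`, of the mixed model when the disorder is typical. -/
noncomputable def mixedWeight (a : ℕ → ℝ) (K : ℝ) (n : ℕ) : ℝ :=
  ((n + 2 : ℕ) : ℝ) ^ 3 * √|a (n + 2)| * (2 * 4 * √(K * (n + 2 : ℕ)))

/-- The signs of `γ`, invisible in `ξ`, never enter the bounds. This is why `R` can depend on `ξ`
and `K` alone. -/
theorem sqrt_abs_xiCoeff (γ : ℕ → ℝ) (n : ℕ) : √|xiCoeff γ (n + 2)| = |γ (n + 2)| := by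
  rw [xiCoeff, if_pos (by omega), abs_of_nonneg (sq_nonneg _), Real.sqrt_sq_eq_abs]

theorem term_le_mixedWeight {K : ℝ} {n : ℕ}
    (hJ : spinNorm (J (n + 2)) < 2 * 4 * √(K * (n + 2 : ℕ)) * √(N : ℝ)) :
    ((n + 2 : ℕ) : ℝ) ^ 3 * |γ (n + 2)| * spinNorm (J (n + 2)) ≤
      mixedWeight (xiCoeff γ) K n * √(N : ℝ) := by
  rw [mixedWeight, sqrt_abs_xiCoeff]
  calc _ ≤ ((n + 2 : ℕ) : ℝ) ^ 3 * |γ (n + 2)| * (2 * 4 * √(K * (n + 2 : ℕ)) * √(N : ℝ)) := by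
        gcongr
    _ = _ := by ring

theorem sqrt_mul_rpow (hN : 1 ≤ N) (b : ℝ) :
    √(N : ℝ) * (N : ℝ) ^ ((1 - b) / 2) = (N : ℝ) ^ (1 - b / 2) := by
  have hN0 : (0 : ℝ) < N := by exact_mod_cast hN
  rw [Real.sqrt_eq_rpow, ← Real.rpow_add hN0]
  congr 1
  ring

variable {K : ℝ}

theorem abs_mixedDir_le (hN : 1 ≤ N) (hw : Summable (mixedWeight (xiCoeff γ) K))
    (hJ : ∀ n, spinNorm (J (n + 2)) < 2 * 4 * √(K * (n + 2 : ℕ)) * √(N : ℝ)) {i : ℕ} (hi : i ≤ 3)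
    {x v : Vec N} (hx : x ∈ ball N) (hv : ‖v‖ = 1) :
    |mixedDir γ J i v x| ≤ (∑' n, mixedWeight (xiCoeff γ) K n) * (N : ℝ) ^ (1 - (i : ℝ) / 2) := by
  rw [← Real.norm_eq_abs]
  refine tsum_of_norm_bounded (hw.hasSum.mul_right _) fun n => ?_
  rw [Real.norm_eq_abs, abs_mul]
  calc |γ (n + 2)| * |pureDir (n + 2) (J (n + 2)) i v x|
      ≤ |γ (n + 2)| * (((n + 2 : ℕ) : ℝ) ^ 3 * spinNorm (J (n + 2)) *
          (N : ℝ) ^ ((1 - (i : ℝ)) / 2)) := by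
        refine mul_le_mul_of_nonneg_left ((abs_pureDir_le _ hN i hv hx).trans ?_) (abs_nonneg _)
        have h0 := spinNorm_nonneg (J (n + 2))
        gcongr
        exact descFactorial_le_cube (by omega) hi
    _ = (((n + 2 : ℕ) : ℝ) ^ 3 * |γ (n + 2)| * spinNorm (J (n + 2))) *
          (N : ℝ) ^ ((1 - (i : ℝ)) / 2) := by ring
    _ ≤ mixedWeight (xiCoeff γ) K n * √(N : ℝ) * (N : ℝ) ^ ((1 - (i : ℝ)) / 2) := by
        exact mul_le_mul_of_nonneg_right (term_le_mixedWeight (hJ n)) (by positivity)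
    _ = _ := by rw [mul_assoc, sqrt_mul_rpow hN]

theorem opNorm_mixedHess_sub_le (hN : 1 ≤ N) (hw : Summable (mixedWeight (xiCoeff γ) K))
    (hJ : ∀ n, spinNorm (J (n + 2)) < 2 * 4 * √(K * (n + 2 : ℕ)) * √(N : ℝ))
    {x y : Vec N} (hx : x ∈ ball N) (hy : y ∈ ball N) :
    opNorm (mixedHess γ J x - mixedHess γ J y) ≤
      (∑' n, mixedWeight (xiCoeff γ) K n) / √(N : ℝ) * ‖x - y‖ := by
  have hN0 : (0 : ℝ) < N := by exact_mod_cast hN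
  have hL : ∀ z ∈ ball N, Summable fun n =>
      γ (n + 2) • iteratedFDeriv ℝ 2 (pureH (n + 2) (J (n + 2))) z := by
    intro z hz
    refine Summable.of_norm_bounded ((hw.mul_right √(N : ℝ)).mul_right
      ((N : ℝ) ^ ((1 - ((2 : ℕ) : ℝ)) / 2))) fun n => ?_
    have := norm_iteratedFDeriv_mixed_term_le (γ := γ) (J := J) hN le_rfl (k := 2) (by norm_num) n
      (x := z) (by rw [one_mul]; exact hz)
    rw [iteratedFDeriv_smul_pureH, one_pow, one_mul] at this
    refine this.trans ?_
    exact mul_le_mul_of_nonneg_right (term_le_mixedWeight (hJ n)) (by positivity)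
  have happ : ∀ z ∈ ball N, ∀ j k, mixedHess γ J z j k =
      (∑' n, γ (n + 2) • iteratedFDeriv ℝ 2 (pureH (n + 2) (J (n + 2))) z)
        fun a => EuclideanSpace.single (![j, k] a) (1 : ℝ) := by
    intro z hz j k
    rw [← (summable_multilinear_apply (hL z hz) _).2]
    simp only [mixedHess, Matrix.of_apply, pureHess_eq_iteratedFDeriv, smul_apply, smul_eq_mul]
  have hmat : mixedHess γ J x - mixedHess γ J y = Matrix.of fun j k =>
      ((∑' n, γ (n + 2) • iteratedFDeriv ℝ 2 (pureH (n + 2) (J (n + 2))) x) -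
        ∑' n, γ (n + 2) • iteratedFDeriv ℝ 2 (pureH (n + 2) (J (n + 2))) y)
        fun a => EuclideanSpace.single (![j, k] a) (1 : ℝ) := by
    ext j k
    rw [Matrix.sub_apply, happ x hx, happ y hy, Matrix.of_apply, sub_apply]
  rw [hmat]
  refine (opNorm_of_bilinear_le _).trans ?_
  -- The mean value bound is applied to each degree separately, so the third derivative of the sum
  -- is not needed.
  rw [← (hL x hx).tsum_sub (hL y hy)]
  refine tsum_of_norm_bounded ((hw.hasSum.div_const _).mul_right _) fun n => ?_
  rw [← smul_sub, norm_smul, Real.norm_eq_abs]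
  calc _ ≤ |γ (n + 2)| * (((n + 2 : ℕ) : ℝ) ^ 3 * spinNorm (J (n + 2)) *
          (N : ℝ) ^ ((1 - ((3 : ℕ) : ℝ)) / 2) * ‖x - y‖) := by
        refine mul_le_mul_of_nonneg_left
          ((norm_iteratedFDeriv_two_pureH_sub_le _ hN hx hy).trans ?_) (abs_nonneg _)
        have h0 := spinNorm_nonneg (J (n + 2))
        gcongr
        exact descFactorial_le_cube (by omega) le_rfl
    _ = (((n + 2 : ℕ) : ℝ) ^ 3 * |γ (n + 2)| * spinNorm (J (n + 2))) *
          (N : ℝ) ^ ((1 - ((3 : ℕ) : ℝ)) / 2) * ‖x - y‖ := by ring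
    _ ≤ mixedWeight (xiCoeff γ) K n * √(N : ℝ) * (N : ℝ) ^ ((1 - ((3 : ℕ) : ℝ)) / 2) *
          ‖x - y‖ := by
        exact mul_le_mul_of_nonneg_right (mul_le_mul_of_nonneg_right
          (term_le_mixedWeight (hJ n)) (by positivity)) (norm_nonneg _)
    _ = _ := by
        rw [mul_assoc (mixedWeight _ _ _), sqrt_mul_rpow hN,
          show 1 - ((3 : ℕ) : ℝ) / 2 = -(1 / 2) by norm_num, Real.rpow_neg hN0.le,
          ← Real.sqrt_eq_rpow, div_eq_mul_inv]

end MixedDeterministic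

/-! ### Summability of the weights -/

theorem sqrt_abs_mul_sq_pow_le {b s B : ℝ} (p : ℕ) (hB : |b| * (s ^ 4) ^ p ≤ B) :
    √|b| * (s ^ 2) ^ p ≤ √B := by
  refine Real.le_sqrt_of_sq_le (le_trans (le_of_eq ?_) hB)
  rw [mul_pow, Real.sq_sqrt (abs_nonneg _)]
  ring

/-- The bound gives `√|a p| ≤ √B * s^(-2p)`: one factor `s^(-p)` cancels `s^p`, the other beats
`p^4`. -/
theorem summable_pow_mul_sqrt_abs_of_bounded {a : ℕ → ℝ} {s B : ℝ} (hs1 : 1 < s)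
    (hB : ∀ p, |a p| * (s ^ 4) ^ p ≤ B) :
    Summable fun p : ℕ => s ^ p * (p : ℝ) ^ 4 * √|a p| := by
  have hs0 : 0 < s := one_pos.trans hs1
  have hn : ‖s⁻¹‖ < 1 := by
    rw [Real.norm_of_nonneg (by positivity)]
    exact inv_lt_one_of_one_lt₀ hs1
  refine Summable.of_nonneg_of_le (fun p => by positivity) (fun p => ?_)
    ((summable_pow_mul_geometric_of_norm_lt_one 4 hn).mul_left √B)
  have h1 := sqrt_abs_mul_sq_pow_le p (hB p)
  have e : s ^ p * s⁻¹ ^ p = 1 := by rw [← mul_pow, mul_inv_cancel₀ hs0.ne', one_pow]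
  calc s ^ p * (p : ℝ) ^ 4 * √|a p| = (s ^ p * s⁻¹ ^ p) * (s ^ p * (p : ℝ) ^ 4 * √|a p|) := by
        rw [e, one_mul]
    _ = (√|a p| * (s ^ 2) ^ p) * ((p : ℝ) ^ 4 * s⁻¹ ^ p) := by
        rw [← pow_mul, mul_comm 2, pow_mul]
        ring
    _ ≤ _ := by gcongr

theorem exists_summable_pow_mul_sqrt_abs {a : ℕ → ℝ} (ha : 1 < seriesRadius a) :
    ∃ s : ℝ, 1 < s ∧ Summable fun p : ℕ => s ^ p * (p : ℝ) ^ 4 * √|a p| := by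
  obtain ⟨r, hr1, hr⟩ := ENNReal.lt_iff_exists_nnreal_btwn.1 ha
  have hr1' : (1 : ℝ) < r := by exact_mod_cast hr1
  have hsum : Summable fun p => |a p| * (r : ℝ) ^ p := by
    simpa only [FormalMultilinearSeries.ofScalars_norm, Real.norm_eq_abs] using
      FormalMultilinearSeries.summable_norm_mul_pow _ hr
  obtain ⟨B, hB⟩ := hsum.tendsto_atTop_zero.bddAbove_range
  have hs4 : √√(r : ℝ) ^ 4 = r := by
    rw [show 4 = 2 * 2 from rfl, pow_mul, Real.sq_sqrt (Real.sqrt_nonneg _),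
      Real.sq_sqrt (NNReal.coe_nonneg r)]
  -- The fourth root of some `r` strictly between `1` and the radius of convergence.
  refine ⟨√√(r : ℝ), ?_, summable_pow_mul_sqrt_abs_of_bounded (B := B) ?_ fun p => ?_⟩
  iterate 2
    exact Real.lt_sqrt_of_sq_lt (by
      rw [one_pow]; exact Real.lt_sqrt_of_sq_lt (by rwa [one_pow]))
  rw [hs4]
  exact hB (Set.mem_range_self p)

theorem mixedWeight_nonneg (a : ℕ → ℝ) (K : ℝ) (n : ℕ) : 0 ≤ mixedWeight a K n := by
  unfold mixedWeight; positivity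

/-- The fourth power of `p` is the cube from the derivatives times `√p ≤ p` from the tensor norm. -/
theorem summable_pow_mul_mixedWeight {a : ℕ → ℝ} {K s : ℝ} (hK : 0 ≤ K) (hs : 0 ≤ s)
    (h : Summable fun p : ℕ => s ^ p * (p : ℝ) ^ 4 * √|a p|) :
    Summable fun n => s ^ (n + 2) * mixedWeight a K n := by
  refine Summable.of_nonneg_of_le (fun n => mul_nonneg (by positivity) (mixedWeight_nonneg _ _ _))
    (fun n => ?_) (((summable_nat_add_iff 2).2 h).mul_left (2 * 4 * √K))
  have hp : (1 : ℝ) ≤ (n + 2 : ℕ) := by exact_mod_cast Nat.succ_le_of_lt (by omega)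
  have h1 : √((n + 2 : ℕ) : ℝ) ≤ (n + 2 : ℕ) :=
    Real.sqrt_le_iff.2 ⟨by positivity, by nlinarith⟩
  rw [mixedWeight, Real.sqrt_mul hK]
  calc _ = (2 * 4 * √K) * (s ^ (n + 2) * ((((n + 2 : ℕ) : ℝ) ^ 3 * √((n + 2 : ℕ) : ℝ)) *
        √|a (n + 2)|)) := by ring
    _ ≤ (2 * 4 * √K) * (s ^ (n + 2) * ((((n + 2 : ℕ) : ℝ) ^ 3 * ((n + 2 : ℕ) : ℝ)) *
        √|a (n + 2)|)) := by gcongr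
    _ = _ := by ring

theorem summable_mixedWeight {a : ℕ → ℝ} {K s : ℝ} (hs : 1 ≤ s)
    (h : Summable fun n => s ^ (n + 2) * mixedWeight a K n) : Summable (mixedWeight a K) :=
  h.of_nonneg_of_le (mixedWeight_nonneg a K) fun n =>
    le_mul_of_one_le_left (mixedWeight_nonneg a K n) (one_le_pow₀ hs)

/-! ### Mixed models with random disorder -/

section MixedProbability

variable {N : ℕ} {Ω : Type*} [MeasurableSpace Ω] {P : Measure Ω} [IsProbabilityMeasure P]
  {K : ℝ} {J : (p : ℕ) → (Fin p → Fin N) → Ω → ℝ}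

/-- The event that the disorder of degree `n + 2` is atypically large. -/
def badEvent (K : ℝ) (J : (p : ℕ) → (Fin p → Fin N) → Ω → ℝ) (n : ℕ) : Set Ω :=
  {ω | 2 * 4 * √(K * (n + 2 : ℕ)) * √(N : ℝ) ≤ spinNorm (fun idx => J (n + 2) idx ω)}

theorem IsDisorder.tsum_measure_badEvent_le (h : IsDisorder P K J) (hK : 0 < K) (hN : 1 ≤ N) :
    ∑' n, P (badEvent K J n) ≤ ENNReal.ofReal (Real.exp (-8 * N)) := by
  have hN1 : (1 : ℝ) ≤ N := by exact_mod_cast hN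
  have hterm : ∀ n, P (badEvent K J n) ≤
      ENNReal.ofReal (Real.exp (-8 * N) / 2 / 2 ^ n) := by
    intro n
    refine (h.measure_spinNorm_ge_le hK hN (p := n + 2) (by omega)).trans
      (ENNReal.ofReal_le_ofReal ?_)
    have h1 : Real.exp (-1) ≤ 1 / 2 := by
      rw [Real.exp_neg, ← one_div]
      refine one_div_le_one_div_of_le two_pos ?_
      linarith [Real.add_one_le_exp (1 : ℝ)]
    -- Split `8(n+2)N` as `8N + 8(n+1)N` and keep only `n+1` of the last term. The sum over `n` of
    -- `2^(-(n+1))` is exactly `1`.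
    calc Real.exp (-((4 : ℝ) ^ 2 * ((n + 2 : ℕ) : ℝ) / 2) * N)
        ≤ Real.exp (-8 * N + ((n + 1 : ℕ) : ℝ) * (-1)) := by
          rw [Real.exp_le_exp]
          push_cast
          nlinarith [mul_nonneg (Nat.cast_nonneg (α := ℝ) n) (sub_nonneg.2 hN1)]
      _ = Real.exp (-8 * N) * Real.exp (-1) ^ (n + 1) := by
          rw [Real.exp_add, Real.exp_nat_mul]
      _ ≤ Real.exp (-8 * N) * (1 / 2) ^ (n + 1) := by gcongr
      _ = _ := by rw [one_div, inv_pow, pow_succ]; field_simp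
  refine (ENNReal.tsum_le_tsum hterm).trans ?_
  rw [← ENNReal.ofReal_tsum_of_nonneg (fun n => by positivity) (summable_geometric_two' _),
    tsum_geometric_two']

/-- Borel–Cantelli: almost surely only finitely many degrees are bad, and summability ignores
finitely many terms. -/
theorem IsDisorder.ae_wellDefined (h : IsDisorder P K J) (hK : 0 < K) (hN : 1 ≤ N) {γ : ℕ → ℝ}
    {s : ℝ} (hs : 1 < s) (hw : Summable fun n => s ^ (n + 2) * mixedWeight (xiCoeff γ) K n) :
    ∀ᵐ ω ∂P, WellDefined γ (fun p idx => J p idx ω) := by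
  have hfin : ∑' n, P (badEvent K J n) ≠ ⊤ :=
    ((h.tsum_measure_badEvent_le hK hN).trans_lt ENNReal.ofReal_lt_top).ne
  filter_upwards [ae_eventually_notMem hfin] with ω hω
  refine wellDefined_of_summable hN hs ?_
  refine Summable.of_norm_bounded_eventually_nat (hw.mul_right √(N : ℝ)) ?_
  filter_upwards [hω] with n hn
  have h0 := spinNorm_nonneg (fun idx => J (n + 2) idx ω)
  rw [Real.norm_of_nonneg (by positivity), mul_assoc (s ^ _), mul_assoc (s ^ _),
    mul_assoc (s ^ _)]
  exact mul_le_mul_of_nonneg_left (term_le_mixedWeight (J := fun p idx => J p idx ω)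
    (not_le.1 hn)) (by positivity)

theorem IsDisorder.measure_le_of_subset_iUnion_badEvent (h : IsDisorder P K J) (hK : 0 < K)
    (hN : 1 ≤ N) {A : Set Ω}
    (hA : ∀ ω, (∀ n, spinNorm (fun idx => J (n + 2) idx ω) <
      2 * 4 * √(K * (n + 2 : ℕ)) * √(N : ℝ)) → ω ∉ A) :
    P A ≤ ENNReal.ofReal (Real.exp (-8 * N)) := by
  have hsub : A ⊆ ⋃ n, badEvent K J n := by
    intro ω hω
    by_contra hcon
    refine hA ω (fun n => not_le.1 fun hle => hcon (Set.mem_iUnion.2 ⟨n, hle⟩)) hω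
  exact (measure_mono hsub).trans ((measure_iUnion_le _).trans
    (h.tsum_measure_badEvent_le hK hN))

end MixedProbability

end SpinGlass
open SpinGlass in
theorem proposition2p1 :
    -- the pure `p`-spin Hamiltonians
    (∃ C : ℝ, 0 < C ∧
      ∀ (K : ℝ), 0 < K → ∀ (N : ℕ), 1 ≤ N →
      ∀ (Ω : Type*) [MeasurableSpace Ω] (P : Measure Ω) [IsProbabilityMeasure P]
        (J : (p : ℕ) → (Fin p → Fin N) → Ω → ℝ), IsDisorder P K J →
        (∀ p : ℕ, 2 ≤ p →
          P {ω | 2 * C * √K * (p : ℝ) ^ (3 / 2 : ℝ) * ((p : ℝ) - 1) ≤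
              ⨆ x : ball N, opNorm (pureHess p (fun idx => J p idx ω) (x : Vec N))}
            ≤ ENNReal.ofReal (Real.exp (-(C ^ 2 * p / 2) * N))) ∧
        (∀ i ∈ ({1, 2, 3} : Set ℕ), ∀ p : ℕ, max 2 i ≤ p →
          P {ω | ∃ x ∈ ball N, ∃ v : Vec N, ‖v‖ = 1 ∧
              2 * C * √(K * p) / (N : ℝ) ^ (((i : ℝ) - 2) / 2) * ((p ! : ℝ) / ((p - i)! : ℝ)) ≤
                |pureDir p (fun idx => J p idx ω) i v x|}
            ≤ ENNReal.ofReal (Real.exp (-(C ^ 2 * p / 2) * N))) ∧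
        (∀ p : ℕ, 3 ≤ p →
          P {ω | ∃ x ∈ ball N, ∃ y ∈ ball N, x ≠ y ∧
              2 * C * √(K * p) / √(N : ℝ) * ((p ! : ℝ) / ((p - 3)! : ℝ)) * ‖x - y‖ ≤
                opNorm (pureHess p (fun idx => J p idx ω) x -
                  pureHess p (fun idx => J p idx ω) y)}
            ≤ ENNReal.ofReal (Real.exp (-(C ^ 2 * p / 2) * N)))) ∧
    -- the mixed Hamiltonian; `a` is the coefficient sequence of `ξ`, and `R`, `c` depend
    -- only on `K` and `a`
    (∀ (K : ℝ), 0 < K → ∀ (a : ℕ → ℝ), 1 < seriesRadius a →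
      ∃ R : ℝ, ∃ c : ℝ, 0 < R ∧ 0 < c ∧
        ∀ (γ : ℕ → ℝ), xiCoeff γ = a → ∀ (N : ℕ), 1 ≤ N →
        ∀ (Ω : Type*) [MeasurableSpace Ω] (P : Measure Ω) [IsProbabilityMeasure P]
          (J : (p : ℕ) → (Fin p → Fin N) → Ω → ℝ), IsDisorder P K J →
          (∀ᵐ ω ∂P, WellDefined γ (fun p idx => J p idx ω)) ∧
          (∀ i ∈ ({1, 2, 3} : Set ℕ),
            P {ω | ¬ ∀ x ∈ ball N, ∀ v : Vec N, ‖v‖ = 1 →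
                |mixedDir γ (fun p idx => J p idx ω) i v x| <
                  R * (N : ℝ) ^ (1 - (i : ℝ) / 2)}
              ≤ ENNReal.ofReal (Real.exp (-c * N))) ∧
          P {ω | ¬ ∀ x ∈ ball N, ∀ y ∈ ball N, x ≠ y →
              opNorm (mixedHess γ (fun p idx => J p idx ω) x -
                mixedHess γ (fun p idx => J p idx ω) y) < R / √(N : ℝ) * ‖x - y‖}
            ≤ ENNReal.ofReal (Real.exp (-c * N))) := by
  refine ⟨⟨4, by norm_num, ?_⟩, ?_⟩
  · intro K hK N hN Ω _ P _ J h
    refine ⟨fun p hp => h.measure_iSup_opNorm_pureHess_ge_le hK hN hp,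
      fun i _ p hp => h.measure_exists_pureDir_ge_le hK hN (le_of_max_le_left hp)
        (le_of_max_le_right hp),
      fun p hp => h.measure_exists_pureHess_sub_ge_le hK hN hp⟩
  · intro K hK a ha
    obtain ⟨s, hs, hsum⟩ := exists_summable_pow_mul_sqrt_abs ha
    have hsw := summable_pow_mul_mixedWeight hK.le (zero_le_one.trans hs.le) hsum
    have hw := summable_mixedWeight hs.le hsw
    have hW : 0 ≤ ∑' n, mixedWeight a K n := tsum_nonneg (mixedWeight_nonneg a K)
    -- The added `1` makes `R` positive and the inequalities strict. Both constants are fixed before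
    -- `γ`, `N` and the disorder appear.
    refine ⟨(∑' n, mixedWeight a K n) + 1, 8, by positivity, by norm_num, ?_⟩
    rintro γ rfl N hN Ω _ P _ J h
    have hN0 : (0 : ℝ) < N := by exact_mod_cast hN
    refine ⟨h.ae_wellDefined hK hN hs hsw, fun i hi => ?_, ?_⟩
    · have hi3 : i ≤ 3 := by
        rcases hi with rfl | rfl | rfl <;> norm_num
      refine h.measure_le_of_subset_iUnion_badEvent hK hN fun ω hω => not_not_intro ?_
      intro x hx v hv
      refine (abs_mixedDir_le (J := fun p idx => J p idx ω) hN hw hω hi3 hx hv).trans_lt ?_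
      have := Real.rpow_pos_of_pos hN0 (1 - (i : ℝ) / 2)
      linarith
    · refine h.measure_le_of_subset_iUnion_badEvent hK hN fun ω hω => not_not_intro ?_
      intro x hx y hy hxy
      refine (opNorm_mixedHess_sub_le (J := fun p idx => J p idx ω) hN hw hω hx hy).trans_lt ?_
      have h1 : 0 < ‖x - y‖ := norm_pos_iff.2 (sub_ne_zero.2 hxy)
      have h2 := Real.sqrt_pos.2 hN0
      gcongr
      linarith
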